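/- Let $n\ge 3$ and let $(M,g)$ be a smooth Riemannian manifold of dimension $n$ of constant curvature, i.e. $R_{ijkl}=\kappa\,(g_{ik}g_{jl}-g_{il}g_{jk})$ for a constant $\kappa$. Indices are raised and lowered with $g$, a comma denotes the Levi-Civita covariant derivative, $R_{ij}=R^a{}_{iaj}$ is the Ricci tensor, $R=R^a{}_a$ the scalar curvature, $W_{ijkl}$ the Weyl tensor. The subscript $\circ$, and a ring over a symmetric tensor of valence two, denote the completely trace-free part. For a tensor field $T_{ijk}$ put $$t_j=T_{ij}{}^i,\qquad \bar t_i=\frac{n}{(n+2)(n-1)}\,T_{ij}{}^j,\qquad \mathring T_{ijk}=\tfrac16\bigl(\mathrm{Sym}_{ijk}\,T_{ijk}\bigr)_\circ ,$$ $$Z_{ij}=\mathring T_i{}^{ab}\mathring T_{jab}-(n-2)\bigl(\mathring T_{ij}{}^a\bar t_a+\bar t_i\bar t_j\bigr)-R_{ij},$$ where $\mathrm{Sym}_{ijk}$ is the sum over all six permutations of $i,j,k$. Let $x_0\in M$, let $U$ be a connected open neighbourhood of $x_0$, and let $T_{ijk}$ be a tensor field of class $C^1$ on $U$ that solves the following system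 on $U$: $$T_{ijk,l}=\mathring T_{ijk,l}+\Bigl(\bar t_{i,l}\,g_{jk}-\tfrac1n g_{ij}\bar t_{k,l}\Bigr)+\Bigl(\bar t_{j,l}\,g_{ik}-\tfrac1n g_{ij}\bar t_{k,l}\Bigr),$$ $$\mathring T_{ijk,l}=\tfrac1{18}\Bigl(\mathrm{Sym}_{ijk}\Bigl[\mathring T_{ij}{}^a\mathring T_{kla}+\mathring T_{ijk}\bar t_l+3\mathring T_{ijl}\bar t_k+\Bigl(\tfrac4{n-2}\mathring T_i{}^{ab}\mathring T_{jab}-3\mathring T_{ij}{}^a\bar t_a\Bigr)g_{kl}\Bigr]\Bigr)_\circ$$ (trace-free part with respect to $i,j,k$), $$\bar t_{k,l}=\tfrac13\Bigl(-\tfrac2{n-2}\mathring T_k{}^{ab}\mathring T_{lab}+3\mathring T_{kl}{}^a\bar t_a+4\bar t_k\bar t_l\Bigr)_\circ+\tfrac1n g_{kl}\Bigl(\tfrac{3n+2}{6(n+2)(n-1)}\mathring T^{abc}\mathring T_{abc}-\tfrac{n-2}6\bar t^a\bar t_a+\tfrac3{2(n-1)}R\Bigr).$$ Assume that the initial value $T_{ijk}(x_0)$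 satisfies, at $x_0$: 1. the symmetries $T_{jik}=T_{ijk}$ and $g^{ij}T_{ijk}=0$; 2. the linear condition that $T_{ijk}+\frac1{n-1}g_{ij}t_k$ is symmetric in $j,k$; 3. the non-linear conditions $\frac18\bigl(Y\,T^a{}_{ik}T_{ajl}\bigr)_\circ=W_{ijkl}=0$, where $Y$ symmetrises in $i,k$ and in $j,l$ and then antisymmetrises in $i,j$ and in $k,l$ (all without normalisation); $-\frac14\mathring Z_{ij}=\mathring R_{ij}$; and $$\frac{n+2}{9n}\bigl(\mathring T^{abc}\mathring T_{abc}-(n+2)(n-1)\bar t^a\bar t_a-9R\bigr)\bar t_i=-R_{,i}+\frac{2(5n+2)}{3(n-2)}\mathring T_i{}^{ab}\mathring R_{ab}-\frac{2(n^2-2n+8)}{3(n-2)}\mathring R_{ia}\bar t^a .$$ If $t_i=0$ on an open neighbourhood $V\subseteq U$ of $x_0$, then $T_{ijk}=0$ on $V$, and $(M,g)$ is flat, i.e. its Riemann curvature tensor vanishes identically. -/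

import Mathlib

open scoped Manifold ContDiff

noncomputable section

namespace StructureTensor

/-! ### Tensor algebra at a point, in components

`G` is the matrix `g_{ij}` of an inner product and `G⁻¹` its inverse `g^{ij}`. A tensor with `r`
lower indices is given by its components. -/

variable {n : ℕ}

/-- Components of a tensor with one lower index. -/
abbrev Ten1 (n : ℕ) : Type := Fin n → ℝ

/-- Components of a tensor with two lower indices. -/
abbrev Ten2 (n : ℕ) : Type := Fin n → Fin n → ℝ

/-- Components of a tensor with three lower indices. -/
abbrev Ten3 (n : ℕ) : Type := Fin n → Fin n → Fin n → ℝ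

/-- Components of a tensor with four lower indices. -/
abbrev Ten4 (n : ℕ) : Type := Fin n → Fin n → Fin n → Fin n → ℝ

/-- The matrices used as components of a metric. -/
abbrev Mat (n : ℕ) : Type := Matrix (Fin n) (Fin n) ℝ

/-- `g^{ab} S_{ab}`. -/
def trace2 (G : Mat n) (S : Ten2 n) : ℝ := ∑ a, ∑ b, G⁻¹ a b * S a b

/-- The trace-free part of a symmetric tensor `S_{ij}`. -/
def tracefree2 (G : Mat n) (S : Ten2 n) : Ten2 n := fun i j =>
  S i j - 1 / (n : ℝ) * G i j * trace2 G S

/-- Complete symmetrisation: the (unnormalised) sum over all permutations of the indices. -/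
def sym3 (S : Ten3 n) : Ten3 n := fun i j k =>
  S i j k + S i k j + S k i j + S k j i + S j k i + S j i k

/-- The trace-free part of a totally symmetric tensor `S_{ijk}`. -/
def tracefree3 (G : Mat n) (S : Ten3 n) : Ten3 n := fun i j k =>
  S i j k - 1 / ((n : ℝ) + 2) *
    (G i j * trace2 G (fun a b => S a b k) + G i k * trace2 G (fun a b => S a b j)
      + G j k * trace2 G (fun a b => S a b i))

/-- The operator of the Young tableau with rows `(i k)`, `(j l)`, symmetrisers first: symmetrise
(without normalisation) in `i, k` and in `j, l`, then antisymmetrise in `i, j` and in `k, l`. -/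
def youngStar (S : Ten4 n) : Ten4 n :=
  let P : Ten4 n := fun i j k l => S i j k l + S k j i l + S i l k j + S k l i j
  fun i j k l => P i j k l - P j i k l - P i j l k + P j i l k

/-- The Ricci contraction `g^{ab} S_{ajbl}`. -/
def ricciContraction (G : Mat n) (S : Ten4 n) : Ten2 n := fun j l =>
  ∑ a, ∑ b, G⁻¹ a b * S a j b l

/-- The trace-free (Weyl) part of an algebraic curvature tensor `S_{ijkl}`. -/
def weylPart (G : Mat n) (S : Ten4 n) : Ten4 n := fun i j k l =>
  let r := ricciContraction G S
  S i j k l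
    - 1 / ((n : ℝ) - 2) * (G i k * r j l - G i l * r j k - G j k * r i l + G j l * r i k)
    + trace2 G r / (((n : ℝ) - 1) * ((n : ℝ) - 2)) * (G i k * G j l - G i l * G j k)

/-- `S_{ij}{}^a v_a`. -/
def contr31 (G : Mat n) (S : Ten3 n) (v : Ten1 n) : Ten2 n := fun i j =>
  ∑ a, ∑ b, G⁻¹ a b * S i j a * v b

/-- `S_i{}^a v_a`. -/
def contr21 (G : Mat n) (S : Ten2 n) (v : Ten1 n) : Ten1 n := fun i =>
  ∑ a, ∑ b, G⁻¹ a b * S i a * v b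

/-- `S_i{}^{ab} A_{ab}`. -/
def contr32 (G : Mat n) (S : Ten3 n) (A : Ten2 n) : Ten1 n := fun i =>
  ∑ a, ∑ b, ∑ c, ∑ d, G⁻¹ a c * G⁻¹ b d * S i a b * A c d

/-- `S_i{}^{ab} S_{jab}`. -/
def square2 (G : Mat n) (S : Ten3 n) : Ten2 n := fun i j =>
  ∑ a, ∑ b, ∑ c, ∑ d, G⁻¹ a c * G⁻¹ b d * S i a b * S j c d

/-- `S_{ij}{}^a S_{kla}`. -/
def square4 (G : Mat n) (S : Ten3 n) : Ten4 n := fun i j k l =>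
  ∑ a, ∑ b, G⁻¹ a b * S i j a * S k l b

/-- `S^{abc} S_{abc}`. -/
def normSq3 (G : Mat n) (S : Ten3 n) : ℝ := trace2 G (square2 G S)

/-- `v^a v_a`. -/
def normSq1 (G : Mat n) (v : Ten1 n) : ℝ := ∑ a, ∑ b, G⁻¹ a b * v a * v b

/-- The trace `t_j = T_{ij}{}^i`. -/
def traceT (G : Mat n) (T : Ten3 n) : Ten1 n := fun j => ∑ i, ∑ k, G⁻¹ i k * T i j k

/-- The trace-free part `T̊` of `T`, the trace-free part of its total symmetrisation. -/
def Tring (G : Mat n) (T : Ten3 n) : Ten3 n := fun i j k =>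
  1 / 6 * tracefree3 G (sym3 T) i j k

/-- The rescaled trace `t̄_i = n / ((n + 2) (n - 1)) T_{ij}{}^j`. -/
def tbar (G : Mat n) (T : Ten3 n) : Ten1 n := fun i =>
  (n : ℝ) / (((n : ℝ) + 2) * ((n : ℝ) - 1)) * ∑ j, ∑ k, G⁻¹ j k * T i j k

/-- The tensor `Z_{ij}` built from `T` and the Ricci tensor `Ric`. -/
def Ztensor (G : Mat n) (T : Ten3 n) (Ric : Ten2 n) : Ten2 n := fun i j =>
  square2 G (Tring G T) i j
    - ((n : ℝ) - 2) * (contr31 G (Tring G T) (tbar G T) i j + tbar G T i * tbar G T j)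
    - Ric i j

/-! ### Calculus in coordinates

`G y` is the matrix of the metric at the coordinate point `y`, and tensor fields are given by their
component functions. -/

/-- The coordinate space. -/
abbrev Coord (n : ℕ) : Type := EuclideanSpace ℝ (Fin n)

/-- The partial derivative `∂_k f` at `y`. -/
def pd (k : Fin n) (f : Coord n → ℝ) (y : Coord n) : ℝ :=
  fderiv ℝ f y (EuclideanSpace.single k 1)

/-- The Christoffel symbols `Γ^a_{ij}` of the Levi-Civita connection. -/
def christoffel (G : Coord n → Mat n) (y : Coord n) (a i j : Fin n) : ℝ :=
  1 / 2 * ∑ b, (G y)⁻¹ a b *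
    (pd i (fun z => G z b j) y + pd j (fun z => G z b i) y - pd b (fun z => G z i j) y)

/-- The covariant derivative `v_{k,l}`. -/
def cov1 (G : Coord n → Mat n) (v : Coord n → Ten1 n) (y : Coord n) : Ten2 n := fun k l =>
  pd l (fun z => v z k) y - ∑ a, christoffel G y a l k * v y a

/-- The covariant derivative `S_{ijk,l}`. -/
def cov3 (G : Coord n → Mat n) (S : Coord n → Ten3 n) (y : Coord n) : Ten4 n := fun i j k l =>
  pd l (fun z => S z i j k) y
    - ∑ a, (christoffel G y a l i * S y a j k + christoffel G y a l j * S y i a k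
        + christoffel G y a l k * S y i j a)

/-- The Riemann curvature `R^a{}_{bcd}`, in the sign convention
`v_{b,cd} - v_{b,dc} = R^a{}_{bcd} v_a`. -/
def riemannUp (G : Coord n → Mat n) (y : Coord n) (a b c d : Fin n) : ℝ :=
  pd c (fun z => christoffel G z a d b) y - pd d (fun z => christoffel G z a c b) y
    + ∑ e, (christoffel G y a c e * christoffel G y e d b
        - christoffel G y a d e * christoffel G y e c b)

/-- The Riemann curvature `R_{ijkl}`. -/
def riemann (G : Coord n → Mat n) (y : Coord n) : Ten4 n := fun i j k l =>
  ∑ a, G y i a * riemannUp G y a j k l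

/-- The Ricci curvature `R_{jl} = g^{ik} R_{ijkl}`. -/
def ricci (G : Coord n → Mat n) (y : Coord n) : Ten2 n := ricciContraction (G y) (riemann G y)

/-- The scalar curvature. -/
def scal (G : Coord n → Mat n) (y : Coord n) : ℝ := trace2 (G y) (ricci G y)

/-- The trace-free part of the Ricci tensor. -/
def ricciRing (G : Coord n → Mat n) (y : Coord n) : Ten2 n := tracefree2 (G y) (ricci G y)

/-! ### The equations for the structure tensor, in coordinates -/

/-- `T_{jik} = T_{ijk}` and `g^{ij} T_{ijk} = 0`. -/
def Symmetries (G : Mat n) (T : Ten3 n) : Prop :=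
  (∀ i j k, T j i k = T i j k) ∧ ∀ k, trace2 G (fun i j => T i j k) = 0

/-- `T_{ijk} + g_{ij} t_k / (n - 1)` is symmetric in `j, k`. -/
def LinearCondition (G : Mat n) (T : Ten3 n) : Prop :=
  ∀ i j k, T i j k + 1 / ((n : ℝ) - 1) * G i j * traceT G T k
    = T i k j + 1 / ((n : ℝ) - 1) * G i k * traceT G T j

/-- The system of partial differential equations at the coordinate point `y`: the derivative of `T`
in terms of those of `T̊` and `t̄`, and the polynomial expressions for the latter two. -/
def DerivativeEquations (G : Coord n → Mat n) (T : Coord n → Ten3 n) (y : Coord n) : Prop :=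
  let g := G y
  let S := Tring g (T y)
  let t := tbar g (T y)
  let DT := cov3 G T y
  let DS := cov3 G (fun z => Tring (G z) (T z)) y
  let Dt := cov1 G (fun z => tbar (G z) (T z)) y
  (∀ i j k l, DT i j k l = DS i j k l
      + ((Dt i l * g j k - 1 / (n : ℝ) * g i j * Dt k l)
        + (Dt j l * g i k - 1 / (n : ℝ) * g j i * Dt k l)))
  ∧ (∀ i j k l, DS i j k l = 1 / 18 * tracefree3 g (sym3 (fun p q r =>
      square4 g S p q r l + S p q r * t l + 3 * S p q l * t r
        + (4 / ((n : ℝ) - 2) * square2 g S p q - 3 * contr31 g S t p q) * g r l)) i j k)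
  ∧ (∀ k l, Dt k l = 1 / 3 * tracefree2 g (fun p q =>
        -2 / ((n : ℝ) - 2) * square2 g S p q + 3 * contr31 g S t p q + 4 * t p * t q) k l
      + 1 / (n : ℝ) * g k l *
        ((3 * (n : ℝ) + 2) / (6 * ((n : ℝ) + 2) * ((n : ℝ) - 1)) * normSq3 g S
          - ((n : ℝ) - 2) / 6 * normSq1 g t
          + 3 / (2 * ((n : ℝ) - 1)) * scal G y))

/-- The Weyl part of the quadratic tensor `T^a{}_{ik} T_{ajl}` is the Weyl curvature, and the latter
vanishes. -/
def WeylCondition (G : Coord n → Mat n) (T : Ten3 n) (y : Coord n) : Prop :=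
  ∀ i j k l,
    1 / 8 * weylPart (G y) (youngStar (fun p q r s =>
        ∑ a, ∑ b, (G y)⁻¹ a b * T a p r * T b q s)) i j k l
      = weylPart (G y) (riemann G y) i j k l
    ∧ weylPart (G y) (riemann G y) i j k l = 0

/-- `-Z̊_{ij} / 4 = R̊_{ij}`. -/
def RicciCondition (G : Coord n → Mat n) (T : Ten3 n) (y : Coord n) : Prop :=
  ∀ i j, -1 / 4 * tracefree2 (G y) (Ztensor (G y) T (ricci G y)) i j = ricciRing G y i j

/-- The polynomial condition with one free index, involving the derivative `R_{,i}` of the scalar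
curvature. -/
def OneIndexCondition (G : Coord n → Mat n) (T : Ten3 n) (y : Coord n) : Prop :=
  let g := G y
  let S := Tring g T
  let t := tbar g T
  ∀ i, ((n : ℝ) + 2) / (9 * n) *
        (normSq3 g S - ((n : ℝ) + 2) * ((n : ℝ) - 1) * normSq1 g t - 9 * scal G y) * t i
      = - pd i (scal G) y
        + 2 * (5 * (n : ℝ) + 2) / (3 * ((n : ℝ) - 2)) * contr32 g S (ricciRing G y) i
        - 2 * ((n : ℝ) ^ 2 - 2 * n + 8) / (3 * ((n : ℝ) - 2)) * contr21 g (ricciRing G y) t i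

/-! ### Riemannian manifolds and tensor fields -/

section Manifold

variable {M : Type*} [TopologicalSpace M] [ChartedSpace (EuclideanSpace ℝ (Fin n)) M]

/-- The coordinate vector `∂_i` of the chart `φ`, at the point with coordinates `y`. -/
def frame (φ : OpenPartialHomeomorph M (EuclideanSpace ℝ (Fin n))) (y : Coord n) (i : Fin n) :
    TangentSpace (𝓡 n) (φ.symm y) :=
  mfderiv (𝓡 n) (𝓡 n) φ.symm y (EuclideanSpace.single i (1 : ℝ))

/-- A covariant tensor of valence three at each point. -/
abbrev TensorField3 (n : ℕ) (M : Type*) [TopologicalSpace M]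
    [ChartedSpace (EuclideanSpace ℝ (Fin n)) M] : Type _ :=
  ∀ x : M, TangentSpace (𝓡 n) x →L[ℝ] TangentSpace (𝓡 n) x →L[ℝ] TangentSpace (𝓡 n) x →L[ℝ] ℝ

/-- The components of a tensor field in the chart `φ`. -/
def components (T : TensorField3 n M)
    (φ : OpenPartialHomeomorph M (EuclideanSpace ℝ (Fin n))) (y : Coord n) : Ten3 n :=
  fun i j k => T (φ.symm y) (frame φ y i) (frame φ y j) (frame φ y k)

/-- The tensor field has continuously differentiable components on `U`, in every chart. -/
def IsC1On (T : TensorField3 n M) (U : Set M) : Prop :=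
  ∀ φ ∈ atlas (EuclideanSpace ℝ (Fin n)) M, ∀ i j k,
    ContDiffOn ℝ 1 (fun y => components T φ y i j k) (φ.target ∩ φ.symm ⁻¹' U)

variable [IsManifold (𝓡 n) ∞ M]

/-- Smooth Riemannian metrics on `M`. -/
abbrev Metric (n : ℕ) (M : Type*) [TopologicalSpace M]
    [ChartedSpace (EuclideanSpace ℝ (Fin n)) M] [IsManifold (𝓡 n) ∞ M] : Type _ :=
  Bundle.ContMDiffRiemannianMetric (𝓡 n) ∞ (EuclideanSpace ℝ (Fin n))
    (fun x : M => TangentSpace (𝓡 n) x)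

/-- The matrix `g_{ij}` of the metric in the chart `φ`. -/
def gram (g : Metric n M) (φ : OpenPartialHomeomorph M (EuclideanSpace ℝ (Fin n)))
    (y : Coord n) : Mat n :=
  Matrix.of fun i j => g.inner (φ.symm y) (frame φ y i) (frame φ y j)

/-- The metric has constant curvature `κ`. -/
def HasConstantCurvature (g : Metric n M) (κ : ℝ) : Prop :=
  ∀ φ ∈ atlas (EuclideanSpace ℝ (Fin n)) M, ∀ y ∈ φ.target, ∀ i j k l,
    riemann (gram g φ) y i j k l
      = κ * (gram g φ y i k * gram g φ y j l - gram g φ y i l * gram g φ y j k)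

/-- The Riemann curvature tensor of the metric vanishes identically. -/
def IsFlat (g : Metric n M) : Prop :=
  ∀ φ ∈ atlas (EuclideanSpace ℝ (Fin n)) M, ∀ y ∈ φ.target, ∀ i j k l,
    riemann (gram g φ) y i j k l = 0

/-- `T` solves the system of partial differential equations on `U`. -/
def SolvesOn (g : Metric n M) (T : TensorField3 n M) (U : Set M) : Prop :=
  ∀ φ ∈ atlas (EuclideanSpace ℝ (Fin n)) M, ∀ y ∈ φ.target, φ.symm y ∈ U →
    DerivativeEquations (gram g φ) (components T φ) y

/-- The conditions on the initial value of `T` at the point `x₀`: symmetries, the linear condition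
and the polynomial conditions. -/
def AdmissibleAt (g : Metric n M) (T : TensorField3 n M) (x₀ : M) : Prop :=
  ∀ φ ∈ atlas (EuclideanSpace ℝ (Fin n)) M, x₀ ∈ φ.source →
    Symmetries (gram g φ (φ x₀)) (components T φ (φ x₀))
    ∧ LinearCondition (gram g φ (φ x₀)) (components T φ (φ x₀))
    ∧ WeylCondition (gram g φ) (components T φ (φ x₀)) (φ x₀)
    ∧ RicciCondition (gram g φ) (components T φ (φ x₀)) (φ x₀)
    ∧ OneIndexCondition (gram g φ) (components T φ (φ x₀)) (φ x₀)

/-- The trace `t_j = T_{ij}{}^i` vanishes at all points of `V`. -/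
def TraceVanishesOn (g : Metric n M) (T : TensorField3 n M) (V : Set M) : Prop :=
  ∀ φ ∈ atlas (EuclideanSpace ℝ (Fin n)) M, ∀ y ∈ φ.target, φ.symm y ∈ V →
    ∀ j, traceT (gram g φ y) (components T φ y) j = 0

end Manifold

end StructureTensor

end

noncomputable section

namespace StructureTensor

open Matrix Filter Topology Bundle
open scoped MatrixOrder

/-! The symmetry and linear conditions say that two tensors vanish at `x₀`: `antisym12`, the
antisymmetric part of `T` in its first two indices, and `hookDefect`, the failure of symmetry in the
last two after correction by `t̄`. The first equation of the system makes both of them parallel, so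
they vanish on all of the connected set `U` (`isReduced_of_isPreconnected`). On `V`, where `t = 0`,
it follows that `t̄ = 0` and that `T` equals its trace-free part `S = T̊`, a totally symmetric
trace-free tensor.

With `t̄ = 0` the equation for `t̄_{k,l}` becomes algebraic. Its trace-free part and its trace give
`S_i^{ab} S_{jab} = q g_{ij}`, where `q` is a nonzero constant times `κ` (`square2_eq`).

Two relations then hold for the cubic form `C_{ijk} = tr(S_i S_j S_k)`. Differentiating `S_i^{ab}
S_{jab} = q g_{ij}` and inserting the equation for `S_{ijk,l}` gives `2 C + q (n-2)/(n+2) S = 0`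
(`raise_cov3_add_eq_zero`, `trace_raise_derivRHS`). Contracting the Weyl condition at `x₀` with `S`
gives `C = q (n-2)/(n-1) S` (`cubic_of_weyl`). Together they give `q S = 0` at `x₀`, because the
coefficients add up to a positive number. If `q` were nonzero, then `S = 0` there, and `q g = 0`
would be a contradiction. Hence `q = 0` and `κ = 0`, so the metric is flat. Now `S_i^{ab} S_{jab} =
0` on `V`, and positive definiteness of `g` gives `S = 0`. -/

/-! ### Symmetric trace-free tensors as families of matrices. -/

/-- The matrix `S_{i··}`. -/
def slice {n : ℕ} (S : Ten3 n) (i : Fin n) : Mat n := Matrix.of (S i)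

/-- The endomorphism `S_i{}^a{}_b`. -/
def endo {n : ℕ} (G : Mat n) (S : Ten3 n) (i : Fin n) : Mat n := G⁻¹ * slice S i

/-- A totally symmetric and trace-free tensor. -/
structure IsHarmonic {n : ℕ} (G : Mat n) (S : Ten3 n) : Prop where
  swap12 : ∀ i j k, S j i k = S i j k
  swap23 : ∀ i j k, S i k j = S i j k
  trace : ∀ k, trace2 G (fun a b => S a b k) = 0

variable {n : ℕ} {G : Mat n} {S : Ten3 n}

lemma trace2_eq_trace (S : Ten2 n) : trace2 G S = (G⁻¹ * (Matrix.of S)ᵀ).trace := by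
  simp [trace2, Matrix.trace, Matrix.mul_apply]

lemma trace2_sub (A B : Ten2 n) :
    trace2 G (fun a b => A a b - B a b) = trace2 G A - trace2 G B := by
  simp [trace2, mul_sub, Finset.sum_sub_distrib]

lemma trace2_add (A B : Ten2 n) :
    trace2 G (fun a b => A a b + B a b) = trace2 G A + trace2 G B := by
  simp [trace2, mul_add, Finset.sum_add_distrib]

lemma trace2_smul (c : ℝ) (A : Ten2 n) : trace2 G (fun a b => c * A a b) = c * trace2 G A := by
  simp only [trace2, Finset.mul_sum]
  exact Finset.sum_congr rfl fun _ _ => Finset.sum_congr rfl fun _ _ => by ring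

lemma inv_symm (hG : G.IsSymm) (a b : Fin n) : G⁻¹ a b = G⁻¹ b a := by
  have : (G⁻¹)ᵀ = G⁻¹ := by rw [transpose_nonsing_inv, hG.eq]
  exact congrFun (congrFun this b) a

lemma IsHarmonic.slice_transpose (h : IsHarmonic G S) (i : Fin n) : (slice S i)ᵀ = slice S i := by
  ext a b; exact h.swap23 _ _ _

lemma trace2_metric (hG : G.IsSymm) (hu : IsUnit G.det) :
    trace2 G (fun i j => G i j) = n := by
  rw [trace2_eq_trace]
  change (G⁻¹ * Gᵀ).trace = n
  rw [hG.eq, nonsing_inv_mul _ hu]; simp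

lemma sum_swap13 (f : Fin n → Fin n → Fin n → ℝ) :
    ∑ a, ∑ b, ∑ c, f a b c = ∑ c, ∑ b, ∑ a, f a b c := by
  rw [Finset.sum_congr rfl (fun a _ => Finset.sum_comm), Finset.sum_comm]
  exact Finset.sum_congr rfl fun a _ => Finset.sum_comm

/-- The transpose is kept so that no symmetry of `S` is needed; the positivity argument in
`eq_zero_of_square2_eq_zero` uses this form. -/
lemma square2_eq_trace_transpose (hG : G.IsSymm) (S : Ten3 n) (i j : Fin n) :
    square2 G S i j = (G⁻¹ * slice S i * G⁻¹ * (slice S j)ᵀ).trace := by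
  rw [Matrix.mul_assoc (G⁻¹ * slice S i)]
  simp only [square2, Matrix.trace, Matrix.diag, Matrix.mul_apply, slice, Matrix.of_apply,
    Finset.sum_mul, Finset.mul_sum, Matrix.transpose_apply]
  rw [sum_swap13]
  refine Finset.sum_congr rfl fun c _ => Finset.sum_congr rfl fun b _ =>
    (Finset.sum_congr rfl fun a _ => Finset.sum_congr rfl fun d _ => ?_).trans Finset.sum_comm
  rw [inv_symm hG a c]; ring

lemma square2_eq_trace (hG : G.IsSymm) (h : IsHarmonic G S) (i j : Fin n) :
    square2 G S i j = (endo G S i * endo G S j).trace := by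
  rw [square2_eq_trace_transpose hG, h.slice_transpose, endo, endo]
  simp only [Matrix.mul_assoc]

lemma square4_eq (h : IsHarmonic G S) (i j k l : Fin n) :
    square4 G S i j k l = (slice S i * G⁻¹ * slice S k) j l := by
  simp only [square4, Matrix.mul_apply, slice, Matrix.of_apply, Finset.sum_mul]
  rw [Finset.sum_comm]
  refine Finset.sum_congr rfl fun b _ => Finset.sum_congr rfl fun a _ => ?_
  rw [h.swap23 k b l]; ring

lemma metric_mul_endo (hu : IsUnit G.det) (i : Fin n) : G * endo G S i = slice S i := by
  rw [endo, ← Matrix.mul_assoc, mul_nonsing_inv _ hu, Matrix.one_mul]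

lemma IsHarmonic.trace_endo (h : IsHarmonic G S) (i : Fin n) :
    (endo G S i).trace = 0 := by
  rw [← h.trace i, trace2_eq_trace, endo]
  congr 2
  ext a b
  simp [slice, h.swap12 i, h.swap23]

/-- The cubic form `tr (S_i S_j S_k)`. -/
def cubic {n : ℕ} (G : Mat n) (S : Ten3 n) (i j k : Fin n) : ℝ :=
  (endo G S i * endo G S j * endo G S k).trace

lemma cubic_rotate (i j k : Fin n) : cubic G S i j k = cubic G S k i j := by
  rw [cubic, cubic, Matrix.trace_mul_comm, Matrix.mul_assoc]

/-- A trace is invariant under transposition, which reverses the product of the symmetric factors.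
With `cubic_rotate` this makes the cubic form totally symmetric. -/
lemma cubic_swap (hG : G.IsSymm) (h : IsHarmonic G S) (i j k : Fin n) :
    cubic G S i j k = cubic G S j i k := by
  have hi : (G⁻¹)ᵀ = G⁻¹ := by rw [transpose_nonsing_inv, hG.eq]
  rw [cubic, ← Matrix.trace_transpose]
  simp only [endo, transpose_mul, hi, h.slice_transpose]
  rw [← Matrix.mul_assoc, ← Matrix.mul_assoc, Matrix.trace_mul_comm, cubic_rotate, cubic]
  simp only [endo, Matrix.mul_assoc]

/-- The tensor `S_j` with both indices raised. -/
def raise {n : ℕ} (G : Mat n) (S : Ten3 n) (j : Fin n) : Mat n := endo G S j * G⁻¹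

lemma trace_raise_mul_slice_mul (i j k : Fin n) :
    (raise G S j * (slice S i * G⁻¹ * slice S k)).trace = cubic G S j i k := by
  simp only [cubic, raise, endo, Matrix.mul_assoc]

lemma trace_raise_mul_slice (hG : G.IsSymm) (h : IsHarmonic G S) (i j : Fin n) :
    (raise G S j * slice S i).trace = square2 G S j i := by
  rw [square2_eq_trace hG h]
  simp only [raise, endo, Matrix.mul_assoc]

lemma trace_raise_mul_metric (hu : IsUnit G.det) (h : IsHarmonic G S) (j : Fin n) :
    (raise G S j * G).trace = 0 := by
  rw [raise, Matrix.mul_assoc, nonsing_inv_mul _ hu, Matrix.mul_one, h.trace_endo]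

lemma metric_raise_metric (hu : IsUnit G.det) (j : Fin n) :
    G * raise G S j * G = slice S j := by
  rw [raise, ← Matrix.mul_assoc, metric_mul_endo hu, Matrix.mul_assoc, nonsing_inv_mul _ hu,
    Matrix.mul_one]

lemma trace_raise_mul_vecMulVec (hG : G.IsSymm) (hu : IsUnit G.det) (j i l : Fin n) :
    (raise G S j * vecMulVec (G i) (G l)).trace = S j l i := by
  rw [Matrix.mul_vecMulVec, Matrix.trace_vecMulVec]
  have : slice S j l i = S j l i := rfl
  rw [← this, ← metric_raise_metric hu j, Matrix.mul_assoc, dotProduct_comm]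
  simp only [Matrix.mul_apply, dotProduct, Matrix.mulVec]
  refine Finset.sum_congr rfl fun a _ => ?_
  congr 1
  exact Finset.sum_congr rfl fun b _ => by rw [hG.apply i b]

/-! ### Symmetries and traces of the quadratic tensor `S_{ij}^a S_{kla}`. -/

/-- The right-hand side of the equation for `S_{ijk,l}` when `t̄ = 0`. -/
def derivRHS {n : ℕ} (G : Mat n) (S : Ten3 n) (l : Fin n) : Ten3 n := fun i j k =>
  1 / 18 * tracefree3 G (sym3 (fun p q r => square4 G S p q r l
    + 4 / ((n : ℝ) - 2) * square2 G S p q * G r l)) i j k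

lemma square4_swap (h : IsHarmonic G S) (i j k l : Fin n) :
    square4 G S i j k l = square4 G S j i k l := by
  simp only [square4, h.swap12 i j]

lemma square4_swap' (h : IsHarmonic G S) (i j k l : Fin n) :
    square4 G S i j k l = square4 G S i j l k := by
  simp only [square4, h.swap12 k l]

lemma square4_comm (hG : G.IsSymm) (i j k l : Fin n) :
    square4 G S i j k l = square4 G S k l i j := by
  simp only [square4]
  rw [Finset.sum_comm]
  refine Finset.sum_congr rfl fun b _ => Finset.sum_congr rfl fun a _ => ?_
  rw [inv_symm hG a b]; ring

lemma trace2_square4_left (h : IsHarmonic G S) (k l : Fin n) :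
    trace2 G (fun a b => square4 G S a b k l) = 0 := by
  have : ∀ a b, square4 G S a b k l = ∑ c, endo G S k c l * S a b c := by
    intro a b
    simp only [square4, endo, Matrix.mul_apply, slice, of_apply, Finset.sum_mul]
    refine Finset.sum_congr rfl fun c _ => Finset.sum_congr rfl fun d _ => ?_
    rw [h.swap23 k d l]; ring
  simp only [this, trace2, Finset.mul_sum]
  rw [Finset.sum_congr rfl (fun a _ => Finset.sum_comm), Finset.sum_comm]
  refine Finset.sum_eq_zero fun c _ => ?_
  have := h.trace c
  simp only [trace2] at this
  rw [← mul_zero (endo G S k c l), ← this, Finset.mul_sum]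
  refine Finset.sum_congr rfl fun a _ => ?_
  rw [Finset.mul_sum]
  exact Finset.sum_congr rfl fun b _ => by ring

lemma trace2_square4_mid (hG : G.IsSymm) (h : IsHarmonic G S) (k l : Fin n) :
    trace2 G (fun a b => square4 G S a k b l) = square2 G S k l := by
  rw [trace2_eq_trace, square2_eq_trace hG h]
  have : (of fun a b => square4 G S a k b l)ᵀ = slice S l * G⁻¹ * slice S k := by
    ext a b
    rw [← square4_eq h, transpose_apply, of_apply, square4_comm hG, square4_swap h,
      square4_swap' h]
  rw [this, Matrix.mul_assoc, ← Matrix.mul_assoc, Matrix.trace_mul_comm]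
  rfl

lemma trace2_metric_mul (hG : G.IsSymm) (hu : IsUnit G.det) (A : Mat n) (k l : Fin n) :
    trace2 G (fun a b => G a k * A b l) = A k l := by
  have : ∀ b, ∑ a, G⁻¹ a b * G a k = (1 : Mat n) b k := by
    intro b
    rw [← nonsing_inv_mul _ hu, Matrix.mul_apply]
    exact Finset.sum_congr rfl fun a _ => by rw [inv_symm hG a b]
  simp only [trace2]
  rw [Finset.sum_comm]
  simp only [← mul_assoc, ← Finset.sum_mul, this]
  simp [Matrix.one_apply]

lemma trace2_swap (hG : G.IsSymm) (A : Ten2 n) : trace2 G (fun a b => A b a) = trace2 G A := by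
  simp only [trace2]
  rw [Finset.sum_comm]
  refine Finset.sum_congr rfl fun b _ => Finset.sum_congr rfl fun a _ => ?_
  rw [inv_symm hG a b]

/-! ### The two relations for the cubic form, and positivity. -/

section Algebra

lemma trace2_metric_mul' (hG : G.IsSymm) (hu : IsUnit G.det) (A : Mat n) (k l : Fin n) :
    trace2 G (fun a b => G b k * A a l) = A k l := by
  rw [← trace2_metric_mul hG hu A k l, ← trace2_swap hG]

/-- The trace of the symmetrised tensor in the equation for `S_{ijk,l}`. -/
lemma trace2_sym3_derivRHS (hn : 3 ≤ n) (hG : G.IsSymm) (hu : IsUnit G.det) (h : IsHarmonic G S)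
    {q : ℝ} (hq : ∀ i j, square2 G S i j = q * G i j) (l k : Fin n) :
    trace2 G (fun a b => sym3 (fun p q r => square4 G S p q r l
      + 4 / ((n : ℝ) - 2) * square2 G S p q * G r l) a b k)
      = q * (4 + 8 * (n + 2) / ((n : ℝ) - 2)) * G k l := by
  -- The six permutations coincide in pairs. Of the three products of `S`, one has trace zero and
  -- two have trace `q g_{kl}`; the metric terms have trace `(n + 2) g_{kl}`.
  have e : ∀ a b, sym3 (fun p q r => square4 G S p q r l
      + 4 / ((n : ℝ) - 2) * square2 G S p q * G r l) a b k =
      2 * (square4 G S a b k l + square4 G S a k b l + square4 G S b k a l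
        + (4 * q / ((n : ℝ) - 2)) * (G a b * G k l + G a k * G b l + G b k * G a l)) := by
    intro a b
    simp only [sym3, hq]
    rw [square4_swap h b a, square4_swap h k a, square4_swap h k b, hG.apply a b, hG.apply a k,
      hG.apply b k]
    ring
  simp only [e, trace2_smul, trace2_add, trace2_square4_left h, trace2_square4_mid hG h,
    trace2_metric_mul hG hu, trace2_metric_mul' hG hu]
  have e2 : trace2 G (fun a b => square4 G S b k a l) = square2 G S k l := by
    rw [← trace2_square4_mid hG h, ← trace2_swap hG]
  have e3 : trace2 G (fun a b => G a b * G k l) = n * G k l := by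
    rw [← trace2_metric hG hu, mul_comm, ← trace2_smul]
    simp only [mul_comm]
  rw [e2, e3, hq]
  have : (n : ℝ) - 2 ≠ 0 := by
    have : (3 : ℝ) ≤ n := by exact_mod_cast hn
    linarith
  field_simp
  ring

/-- This pairing of the indices is a linear combination of the slices `S_c`, so its contraction with
`S_j` needs only `S_i^{ab} S_{jab} = q g_{ij}` and produces no cubic form. -/
lemma sum_endo_slice (h : IsHarmonic G S) (i l a b : Fin n) :
    (∑ c, endo G S i c l • slice S c) a b = square4 G S a b i l := by
  simp only [square4, Matrix.sum_apply, Matrix.smul_apply, smul_eq_mul, endo, Matrix.mul_apply,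
    slice, of_apply, Finset.sum_mul]
  refine Finset.sum_congr rfl fun c _ => Finset.sum_congr rfl fun d _ => ?_
  rw [h.swap12 a c b, h.swap23 a b c, h.swap23 i l d]; ring

lemma trace_raise_sum_endo_slice (hG : G.IsSymm) (hu : IsUnit G.det) (h : IsHarmonic G S)
    {q : ℝ} (hq : ∀ i j, square2 G S i j = q * G i j) (i j l : Fin n) :
    (raise G S j * ∑ c, endo G S i c l • slice S c).trace = q * S i j l := by
  have := congrFun (congrFun (metric_mul_endo hu (S := S) i) j) l
  rw [Matrix.mul_apply] at this
  change _ = S i j l at this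
  simp only [Matrix.mul_sum, Matrix.trace_sum, Matrix.mul_smul, Matrix.trace_smul,
    trace_raise_mul_slice hG h, hq, smul_eq_mul]
  rw [← this, Finset.mul_sum]
  exact Finset.sum_congr rfl fun c _ => by ring

/-- The left side is `S_j^{ab} S_{iab,l}`. Two of the three pairings in the symmetrised product
contribute the cubic form and the third contributes `q S_{ijl}`. In the metric terms, `g_{ab}`
contracts to zero and the other two give `S_{ijl}` each; the coefficients then collapse to `q (1 -
4/(n+2))`. -/
lemma trace_raise_derivRHS (hn : 3 ≤ n) (hG : G.IsSymm) (hu : IsUnit G.det) (h : IsHarmonic G S)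
    {q : ℝ} (hq : ∀ i j, square2 G S i j = q * G i j) (i j l : Fin n) :
    (raise G S j * slice (derivRHS G S l) i).trace
      = 1 / 9 * (2 * cubic G S i j l + q * ((n - 2) / (n + 2)) * S i j l) := by
  have hn' : (3 : ℝ) ≤ n := by exact_mod_cast hn
  have h2 : (n : ℝ) - 2 ≠ 0 := by linarith
  have e : slice (derivRHS G S l) i = (1 / 9 : ℝ) • (slice S i * G⁻¹ * slice S l
      + slice S l * G⁻¹ * slice S i + ∑ c, endo G S i c l • slice S c
      + (4 * q / ((n : ℝ) - 2)) • (vecMulVec (G i) (G l) + vecMulVec (G l) (G i) + G i l • G)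
      - (q * (2 + 4 * (n + 2) / ((n : ℝ) - 2)) / (n + 2)) •
        (vecMulVec (G i) (G l) + vecMulVec (G l) (G i) + G i l • G)) := by
    ext a b
    simp only [Matrix.smul_apply, Matrix.add_apply, Matrix.sub_apply, sum_endo_slice h, ← square4_eq h,
      vecMulVec_apply, smul_eq_mul]
    simp only [slice, of_apply, derivRHS, tracefree3, trace2_sym3_derivRHS hn hG hu h hq]
    simp only [sym3, hq]
    rw [square4_swap h a i, square4_swap h b i, square4_swap h b a, square4_comm hG a b,
      square4_comm hG l a i b, square4_swap' h i b a l, square4_swap' h i b l a,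
      square4_swap' h i a l b,
      hG.apply i a, hG.apply i b, hG.apply a b, hG.apply l a, hG.apply l b, square4_comm hG i l a b]
    field_simp
    ring
  rw [e]
  simp only [Matrix.mul_smul, Matrix.mul_add, Matrix.mul_sub, Matrix.trace_smul, Matrix.trace_add,
    Matrix.trace_sub, trace_raise_mul_slice_mul, trace_raise_mul_metric hu h,
    trace_raise_mul_vecMulVec hG hu, trace_raise_sum_endo_slice hG hu h hq, smul_eq_mul]
  rw [cubic_swap hG h j i l, cubic_rotate j l i, h.swap12 i j l, h.swap23 j i l, h.swap12 i j l]
  field_simp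
  ring

/-- The vanishing of the Weyl part of the Young-symmetrised square of `S`. -/
lemma cubic_of_weyl (hn : 3 ≤ n) (hG : G.IsSymm) (hu : IsUnit G.det) (h : IsHarmonic G S)
    {q : ℝ} (hq : ∀ i j, square2 G S i j = q * G i j)
    (hW : ∀ i j k l, weylPart G (youngStar (fun p q r s =>
        ∑ a, ∑ b, G⁻¹ a b * S a p r * S b q s)) i j k l = 0) (i j k : Fin n) :
    cubic G S i j k = q * ((n - 2) / (n - 1)) * S i j k := by
  have hn' : (3 : ℝ) ≤ n := by exact_mod_cast hn
  have h2 : (n : ℝ) - 2 ≠ 0 := by linarith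
  have h1 : (n : ℝ) - 1 ≠ 0 := by linarith
  have e1 : ∀ p q r s, ∑ a, ∑ b, G⁻¹ a b * S a p r * S b q s = square4 G S p r q s := by
    intro p q r s
    simp only [square4]
    refine Finset.sum_congr rfl fun c _ => Finset.sum_congr rfl fun d _ => ?_
    rw [h.swap12 p c r, h.swap23 p r c, h.swap12 q d s, h.swap23 q s d]
  -- The tensor is already symmetric in both pairs, so the symmetrisers only multiply by 4;
  -- exchanging the two factors identifies the remaining four terms two by two.
  have e2 : ∀ i j k l, youngStar (fun p q r s => square4 G S p r q s) i j k l
      = 8 * (square4 G S i k j l - square4 G S i l j k) := by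
    intro i j k l
    simp only [youngStar]
    rw [square4_swap h k i j l, square4_swap' h i k l j, square4_swap h k i l j,
      square4_swap' h i k l j, square4_swap h k j i l, square4_swap' h j k l i,
      square4_swap h k j l i, square4_swap' h j k l i, square4_swap h l i j k,
      square4_swap' h i l k j, square4_swap h l i k j, square4_swap' h i l k j,
      square4_swap h l j i k, square4_swap' h j l k i, square4_swap h l j k i,
      square4_swap' h j l k i, square4_comm hG j k i l, square4_comm hG j l i k]
    ring
  have e3 : ∀ j l, ricciContraction G (fun i j k l =>
      8 * (square4 G S i k j l - square4 G S i l j k)) j l = -8 * q * G j l := by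
    intro j l
    change trace2 G (fun a b => 8 * (square4 G S a b j l - square4 G S a l j b)) = _
    have : ∀ a b, square4 G S a l j b = square4 G S a l b j := fun a b => square4_swap' h _ _ _ _
    simp only [this, trace2_smul, trace2_sub, trace2_square4_left h, trace2_square4_mid hG h, hq,
      hG.apply j l]
    ring
  -- With zero Weyl part the tensor is determined by its Ricci contraction, and since that is a
  -- multiple of `g`, the tensor has the form of constant curvature.
  have e4 : ∀ i j k l, square4 G S i k j l - square4 G S i l j k
      = -q / (n - 1) * (G i k * G j l - G i l * G j k) := by
    intro i j k l
    have := hW i j k l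
    have e5 : youngStar (fun p q r s => ∑ a, ∑ b, G⁻¹ a b * S a p r * S b q s)
      = fun i j k l => 8 * (square4 G S i k j l - square4 G S i l j k) := by
      funext i j k l
      simp only [e1, e2]
    have e6 : ricciContraction G (fun i j k l =>
      8 * (square4 G S i k j l - square4 G S i l j k)) = fun i j => -8 * q * G i j := by
      funext j l
      exact e3 j l
    rw [e5] at this
    simp only [weylPart] at this
    rw [e6] at this
    rw [(trace2_smul (-8 * q) (fun i j => G i j)).trans (by rw [trace2_metric hG hu])] at this
    field_simp at this
    have h3 : ((n : ℝ) - 2) * ((n - 1) * (square4 G S i k j l - square4 G S i l j k)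
        + q * (G i k * G j l - G i l * G j k)) = (n - 2) * 0 := by
      linear_combination (1 / 8) * this
    have h4 := mul_left_cancel₀ h2 h3
    field_simp
    linear_combination h4
  -- The previous identity as an equality of matrices in two of its indices. Contraction with `S_i`
  -- turns it into `q S - C = q/(n-1) S`.
  have e7 : ∑ c, endo G S k c j • slice S c - slice S j * G⁻¹ * slice S k
      = (-q / (n - 1)) • (G k j • G - vecMulVec (G j) (G k)) := by
    ext a b
    simp only [Matrix.sub_apply, Matrix.smul_apply, sum_endo_slice h, ← square4_eq h,
      vecMulVec_apply, smul_eq_mul]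
    rw [square4_swap h j a, e4, hG.apply a j]
    ring
  have e8 := congrArg (fun A => (raise G S i * A).trace) e7
  simp only [Matrix.mul_sub, Matrix.trace_sub, trace_raise_sum_endo_slice hG hu h hq,
    trace_raise_mul_slice_mul, Matrix.mul_smul, Matrix.trace_smul, trace_raise_mul_metric hu h,
    trace_raise_mul_vecMulVec hG hu, smul_eq_mul] at e8
  rw [h.swap12 i k j, h.swap23 i j k] at e8
  field_simp at e8 ⊢
  linear_combination -e8

/-- The two expressions for the cubic form are incompatible unless `q = 0`. -/
lemma eq_zero_of_cubic (hn : 3 ≤ n) (hG0 : G ≠ 0)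
    {q : ℝ} (hq : ∀ i j, square2 G S i j = q * G i j)
    (hc : ∀ i j k, cubic G S i j k = q * ((n - 2) / (n - 1)) * S i j k)
    (hd : ∀ i j k, 2 * cubic G S i j k + q * ((n - 2) / (n + 2)) * S i j k = 0) : q = 0 := by
  have hn' : (3 : ℝ) ≤ n := by exact_mod_cast hn
  by_contra hq0
  apply hG0
  -- If `q ≠ 0`, the two relations force `S = 0`, because both coefficients of `q S` are positive
  -- for `n ≥ 3`.
  have hS : S = 0 := by
    funext i j k
    have := hd i j k
    rw [hc] at this
    have h2 : 0 < (n : ℝ) - 2 := by linarith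
    have h1 : 0 < (n : ℝ) - 1 := by linarith
    have hp : 0 < 2 * (((n : ℝ) - 2) / (n - 1)) + ((n - 2) / (n + 2)) := by positivity
    have h3 : (q * (2 * (((n : ℝ) - 2) / (n - 1)) + ((n - 2) / (n + 2)))) * S i j k = 0 := by
      linear_combination this
    exact (mul_eq_zero.mp h3).resolve_left (mul_ne_zero hq0 hp.ne')
  ext i j
  have := hq i j
  rw [hS] at this
  simpa [square2, hq0] using this

lemma Tring_eq_self (h : IsHarmonic G S) : Tring G S = S := by
  have e : sym3 S = fun i j k => 6 * S i j k := by
    funext i j k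
    simp only [sym3]
    rw [h.swap23 i j k, h.swap12 i k j, h.swap23 i j k, h.swap12 j k i, h.swap23 j i k,
      h.swap12 i j k]
    ring
  funext i j k
  simp only [Tring, e, tracefree3, trace2_smul, h.trace]
  ring

lemma _root_.Matrix.PosDef.isSymm_real (hG : G.PosDef) : G.IsSymm := by
  have := hG.isHermitian
  rwa [IsHermitian, conjTranspose_eq_transpose_of_trivial] at this

/-- A positive definite metric has a vanishing norm only on the zero tensor. -/
lemma eq_zero_of_square2_eq_zero (hG : G.PosDef) (hS : ∀ i, square2 G S i i = 0) : S = 0 := by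
  have hu : IsUnit G.det := hG.det_pos.ne'.isUnit
  -- This factorisation of the inverse metric makes `S_i^{ab} S_{iab}` the squared Frobenius norm of
  -- `B S_i Bᴴ`.
  obtain ⟨B, hB⟩ : ∃ B : Mat n, G⁻¹ = Bᴴ * B :=
    CStarAlgebra.nonneg_iff_eq_star_mul_self.mp hG.inv.posSemidef.nonneg
  have e : ∀ i, square2 G S i i = ((B * slice S i * Bᴴ) * (B * slice S i * Bᴴ)ᴴ).trace := by
    intro i
    rw [square2_eq_trace_transpose hG.isSymm_real, hB]
    simp only [conjTranspose_mul, conjTranspose_conjTranspose, Matrix.mul_assoc]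
    rw [Matrix.trace_mul_comm]
    simp only [conjTranspose_eq_transpose_of_trivial, Matrix.mul_assoc]
  funext i j k
  have h0 : B * slice S i * Bᴴ = 0 := by
    rw [← Matrix.trace_mul_conjTranspose_self_eq_zero_iff, ← e, hS]
  have h1 : G * (Bᴴ * (B * slice S i * Bᴴ) * B) * G = slice S i := by
    have : Bᴴ * (B * slice S i * Bᴴ) * B = G⁻¹ * slice S i * G⁻¹ := by
      rw [hB]; simp only [Matrix.mul_assoc]
    rw [this]
    simp only [Matrix.mul_assoc]
    rw [nonsing_inv_mul _ hu, Matrix.mul_one, ← Matrix.mul_assoc, mul_nonsing_inv _ hu,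
      Matrix.one_mul]
  rw [h0] at h1
  simpa [slice] using (congrFun (congrFun h1 j) k).symm

end Algebra

/-! ### Partial derivatives of matrix-valued functions. -/

section Calculus

variable {n : ℕ} {y : Coord n} {l : Fin n}

lemma pd_sub {f h : Coord n → ℝ} (hf : DifferentiableAt ℝ f y) (hh : DifferentiableAt ℝ h y) :
    pd l (fun z => f z - h z) y = pd l f y - pd l h y := by
  simp [pd, fderiv_fun_sub hf hh]

lemma pd_mul {f h : Coord n → ℝ} (hf : DifferentiableAt ℝ f y) (hh : DifferentiableAt ℝ h y) :
    pd l (fun z => f z * h z) y = pd l f y * h y + f y * pd l h y := by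
  simp [pd, fderiv_fun_mul hf hh]; ring

lemma pd_const_mul (c : ℝ) {f : Coord n → ℝ} (hf : DifferentiableAt ℝ f y) :
    pd l (fun z => c * f z) y = c * pd l f y := by
  simp [pd, fderiv_const_mul hf]

lemma pd_sum {ι : Type*} (s : Finset ι) {f : ι → Coord n → ℝ}
    (hf : ∀ i ∈ s, DifferentiableAt ℝ (f i) y) :
    pd l (fun z => ∑ i ∈ s, f i z) y = ∑ i ∈ s, pd l (f i) y := by
  simp [pd, fderiv_fun_sum hf]

lemma pd_congr {f h : Coord n → ℝ} (e : f =ᶠ[𝓝 y] h) : pd l f y = pd l h y := by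
  rw [pd, pd, e.fderiv_eq]

/-- Entrywise differentiability of a matrix-valued function. -/
def MatDiffAt {n : ℕ} (F : Coord n → Mat n) (y : Coord n) : Prop :=
  ∀ a b, DifferentiableAt ℝ (fun z => F z a b) y

/-- The entrywise partial derivative. -/
def matPd {n : ℕ} (l : Fin n) (F : Coord n → Mat n) (y : Coord n) : Mat n :=
  of fun a b => pd l (fun z => F z a b) y

variable {F H : Coord n → Mat n}

lemma MatDiffAt.mul (hF : MatDiffAt F y) (hH : MatDiffAt H y) :
    MatDiffAt (fun z => F z * H z) y := by
  intro a b
  simp only [Matrix.mul_apply]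
  exact DifferentiableAt.fun_sum fun c _ => (hF a c).mul (hH c b)

lemma matPd_mul (hF : MatDiffAt F y) (hH : MatDiffAt H y) :
    matPd l (fun z => F z * H z) y = matPd l F y * H y + F y * matPd l H y := by
  ext a b
  simp only [matPd, Matrix.add_apply, Matrix.mul_apply, of_apply]
  rw [pd_sum _ fun c _ => (hF a c).fun_mul (hH c b), ← Finset.sum_add_distrib]
  exact Finset.sum_congr rfl fun c _ => pd_mul (hF a c) (hH c b)

lemma pd_trace (hF : MatDiffAt F y) :
    pd l (fun z => (F z).trace) y = (matPd l F y).trace := by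
  simp only [Matrix.trace, Matrix.diag]
  rw [pd_sum _ fun c _ => hF c c]
  rfl

lemma matPd_congr (e : F =ᶠ[𝓝 y] H) : matPd l F y = matPd l H y := by
  ext a b
  exact pd_congr (e.mono fun z hz => congrFun (congrFun hz a) b)

lemma MatDiffAt.det (hF : MatDiffAt F y) : DifferentiableAt ℝ (fun z => (F z).det) y := by
  simp only [Matrix.det_apply]
  refine DifferentiableAt.fun_sum fun σ _ => ?_
  have : DifferentiableAt ℝ (fun z => ∏ i, F z (σ i) i) y := by
    exact (HasFDerivAt.finsetProd (g := fun i z => F z (σ i) i)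
      fun i _ => (hF (σ i) i).hasFDerivAt).differentiableAt
  exact this.fun_const_smul _

lemma MatDiffAt.inv (hF : MatDiffAt F y) (hu : IsUnit (F y).det) :
    MatDiffAt (fun z => (F z)⁻¹) y := by
  intro a b
  simp only [Matrix.inv_def, Matrix.smul_apply, smul_eq_mul, Ring.inverse_eq_inv',
    Matrix.adjugate_apply]
  refine DifferentiableAt.fun_mul (hF.det.inv hu.ne_zero) (MatDiffAt.det fun c d => ?_)
  by_cases h : c = b
  · subst h; simp
  · simpa [Matrix.updateRow_ne h] using hF c d

lemma MatDiffAt.eventually_isUnit (hF : MatDiffAt F y) (hu : IsUnit (F y).det) :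
    ∀ᶠ z in 𝓝 y, IsUnit (F z).det :=
  (hF.det.continuousAt.eventually_ne hu.ne_zero).mono fun _ hz => hz.isUnit

end Calculus

/-! ### The covariant derivative of `S_i^{ab} S_{jab}`. -/

section Covariant

variable {n : ℕ} {G : Coord n → Mat n} {y : Coord n}

/-- The connection matrix `Γ^a_{lb}`. -/
def connection {n : ℕ} (G : Coord n → Mat n) (y : Coord n) (l : Fin n) : Mat n :=
  of fun a b => christoffel G y a l b

lemma sum_metric_mul_christoffel (hu : IsUnit (G y).det) (k l j : Fin n) :
    ∑ a, G y k a * christoffel G y a l j = 1 / 2 *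
      (pd l (fun z => G z k j) y + pd j (fun z => G z k l) y - pd k (fun z => G z l j) y) := by
  have : ∀ b, ∑ a, G y k a * (G y)⁻¹ a b = (1 : Mat n) k b := fun b => by
    rw [← mul_nonsing_inv _ hu, Matrix.mul_apply]
  simp only [christoffel, Finset.mul_sum]
  rw [Finset.sum_comm]
  simp only [← mul_assoc, mul_comm _ (1 / 2 : ℝ)]
  simp only [mul_assoc, ← Finset.mul_sum]
  simp only [← mul_assoc, ← Finset.sum_mul, this]
  simp [Matrix.one_apply]

/-- Metric compatibility of the Levi-Civita connection, in matrix form. -/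
lemma matPd_metric (hs : ∀ z, (G z).IsSymm) (hu : IsUnit (G y).det) (l : Fin n) :
    matPd l G y = (connection G y l)ᵀ * G y + G y * connection G y l := by
  ext j k
  simp only [matPd, of_apply, Matrix.add_apply, Matrix.mul_apply, transpose_apply, connection]
  rw [sum_metric_mul_christoffel hu]
  have : ∑ a, christoffel G y a l j * G y a k = ∑ a, G y k a * christoffel G y a l j :=
    Finset.sum_congr rfl fun a _ => by rw [(hs y).apply k a, mul_comm]
  rw [this, sum_metric_mul_christoffel hu]
  have e : ∀ a b, (fun z => G z a b) = fun z => G z b a := fun a b =>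
    funext fun z => (hs z).apply b a
  rw [e k j, e l k, e l j]
  ring

lemma pd_metric (hs : ∀ z, (G z).IsSymm) (hu : IsUnit (G y).det) (l j k : Fin n) :
    pd l (fun z => G z j k) y
      = ∑ a, (christoffel G y a l j * G y a k + christoffel G y a l k * G y j a) := by
  have := congrFun (congrFun (matPd_metric hs hu l) j) k
  simp only [matPd, of_apply, Matrix.add_apply, Matrix.mul_apply, transpose_apply,
    connection] at this
  rw [this, ← Finset.sum_add_distrib]
  exact Finset.sum_congr rfl fun a _ => by ring

variable {S : Coord n → Ten3 n}

/-- Componentwise differentiability of a tensor field. -/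
def Ten3DiffAt {n : ℕ} (S : Coord n → Ten3 n) (y : Coord n) : Prop :=
  ∀ i j k, DifferentiableAt ℝ (fun z => S z i j k) y

lemma matPd_slice (i l : Fin n) :
    matPd l (fun z => slice (S z) i) y = slice (fun i j k => cov3 G S y i j k l) i
      + ∑ a, christoffel G y a l i • slice (S y) a
      + (connection G y l)ᵀ * slice (S y) i + slice (S y) i * connection G y l := by
  ext j k
  simp only [matPd, slice, of_apply, Matrix.add_apply, Matrix.mul_apply, transpose_apply,
    connection, cov3, Matrix.sum_apply, Matrix.smul_apply, smul_eq_mul, Finset.sum_add_distrib]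
  simp only [mul_comm (S y i _ _)]
  ring

/-- Obtained by differentiating `G * endo G S i = slice S i`, which avoids a formula for the
derivative of the inverse metric. -/
lemma matPd_endo (hs : ∀ z, (G z).IsSymm) (hd : MatDiffAt G y) (hu : IsUnit (G y).det)
    (hS : Ten3DiffAt S y) (i l : Fin n) :
    matPd l (fun z => endo (G z) (S z) i) y
      = (G y)⁻¹ * slice (fun i j k => cov3 G S y i j k l) i
      + ∑ a, christoffel G y a l i • endo (G y) (S y) a
      + endo (G y) (S y) i * connection G y l - connection G y l * endo (G y) (S y) i := by
  have hSl : MatDiffAt (fun z => slice (S z) i) y := fun a b => hS i a b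
  have hM : MatDiffAt (fun z => endo (G z) (S z) i) y := (hd.inv hu).mul hSl
  have e : (fun z => G z * endo (G z) (S z) i) =ᶠ[𝓝 y] fun z => slice (S z) i :=
    (hd.eventually_isUnit hu).mono fun z hz => metric_mul_endo hz i
  have e1 := matPd_congr (l := l) e
  rw [matPd_mul hd hM, matPd_slice (G := G), matPd_metric hs hu, Matrix.add_mul, Matrix.mul_assoc,
    metric_mul_endo hu] at e1
  have e2 : G y * matPd l (fun z => endo (G z) (S z) i) y
      = slice (fun i j k => cov3 G S y i j k l) i
      + ∑ a, christoffel G y a l i • slice (S y) a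
      + slice (S y) i * connection G y l - G y * connection G y l * endo (G y) (S y) i := by
    rw [eq_sub_iff_add_eq, ← add_left_cancel_iff (a := (connection G y l)ᵀ * slice (S y) i)]
    rw [add_comm (G y * _), ← add_assoc, e1]
    abel
  have e3 := congrArg (fun A => (G y)⁻¹ * A) e2
  simp only [← Matrix.mul_assoc, nonsing_inv_mul _ hu, Matrix.one_mul, Matrix.mul_add,
    Matrix.mul_sub, Matrix.mul_sum, Matrix.mul_smul] at e3
  exact e3

/-- The connection enters the derivative of each endomorphism through a commutator, and these
commutators cancel in the trace of the product. Only the Christoffel terms of the free indices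
remain. -/
lemma pd_trace_endo_mul (hs : ∀ z, (G z).IsSymm) (hd : MatDiffAt G y) (hu : IsUnit (G y).det)
    (hS : Ten3DiffAt S y) (i j l : Fin n) :
    pd l (fun z => (endo (G z) (S z) i * endo (G z) (S z) j).trace) y
      = (raise (G y) (S y) j * slice (fun i j k => cov3 G S y i j k l) i).trace
      + (raise (G y) (S y) i * slice (fun i j k => cov3 G S y i j k l) j).trace
      + ∑ a, (christoffel G y a l i * (endo (G y) (S y) a * endo (G y) (S y) j).trace
        + christoffel G y a l j * (endo (G y) (S y) i * endo (G y) (S y) a).trace) := by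
  have hM : ∀ i, MatDiffAt (fun z => endo (G z) (S z) i) y := fun i =>
    (hd.inv hu).mul fun a b => hS i a b
  rw [pd_trace ((hM i).mul (hM j)), matPd_mul (hM i) (hM j), matPd_endo hs hd hu hS,
    matPd_endo hs hd hu hS]
  set M := fun i => endo (G y) (S y) i with hMdef
  set Γ := connection G y l
  set D := fun i => slice (fun i j k => cov3 G S y i j k l) i
  change (((G y)⁻¹ * D i + ∑ a, christoffel G y a l i • M a + M i * Γ - Γ * M i) * M j
    + M i * ((G y)⁻¹ * D j + ∑ a, christoffel G y a l j • M a + M j * Γ - Γ * M j)).trace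
    = (M j * (G y)⁻¹ * D i).trace + (M i * (G y)⁻¹ * D j).trace
    + ∑ a, (christoffel G y a l i * (M a * M j).trace
        + christoffel G y a l j * (M i * M a).trace)
  simp only [Matrix.add_mul, Matrix.sub_mul, Matrix.mul_add, Matrix.mul_sub, Matrix.trace_add,
    Matrix.trace_sub, Matrix.sum_mul, Matrix.mul_sum, Matrix.trace_sum, Matrix.smul_mul,
    Matrix.mul_smul, Matrix.trace_smul, smul_eq_mul, Finset.sum_add_distrib]
  rw [Matrix.trace_mul_comm _ (M j), Matrix.trace_mul_comm (Γ * M i) (M j)]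
  have : (M j * (Γ * M i)).trace = (M i * (M j * Γ)).trace := by
    rw [← Matrix.mul_assoc, Matrix.trace_mul_comm]
  rw [this]
  simp only [Matrix.mul_assoc]
  ring

/-- If `S` is trace-free symmetric with `S_i^{ab} S_{jab} = q g_{ij}` for a constant `q`, then
the covariant derivative of the left-hand side vanishes. -/
lemma raise_cov3_add_eq_zero (hs : ∀ z, (G z).IsSymm) (hd : MatDiffAt G y)
    (hu : IsUnit (G y).det) (hS : Ten3DiffAt S y) (hh : ∀ᶠ z in 𝓝 y, IsHarmonic (G z) (S z))
    {q : ℝ} (hq : ∀ᶠ z in 𝓝 y, ∀ i j, square2 (G z) (S z) i j = q * G z i j) (i j l : Fin n) :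
    (raise (G y) (S y) j * slice (fun i j k => cov3 G S y i j k l) i).trace
      + (raise (G y) (S y) i * slice (fun i j k => cov3 G S y i j k l) j).trace = 0 := by
  have e0 : ∀ i j, (endo (G y) (S y) i * endo (G y) (S y) j).trace = q * G y i j := fun i j => by
    rw [← square2_eq_trace (hs y) hh.self_of_nhds, hq.self_of_nhds]
  have e1 : (fun z => (endo (G z) (S z) i * endo (G z) (S z) j).trace)
      =ᶠ[𝓝 y] fun z => q * G z i j :=
    (hh.and hq).mono fun z hz => by
      simp only
      rw [← square2_eq_trace (hs z) hz.1, hz.2]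
  have e2 := pd_congr (l := l) e1
  rw [pd_trace_endo_mul hs hd hu hS, pd_const_mul _ (hd i j), pd_metric hs hu] at e2
  simp only [e0] at e2
  -- The Christoffel terms of the free indices equal the derivative of `q g_{ij}`, so they cancel
  -- against the right-hand side.
  have e3 : ∑ a, (christoffel G y a l i * (q * G y a j) + christoffel G y a l j * (q * G y i a))
      = q * ∑ a, (christoffel G y a l i * G y a j + christoffel G y a l j * G y i a) := by
    rw [Finset.mul_sum]
    exact Finset.sum_congr rfl fun a _ => by ring
  rw [e3] at e2
  linarith

end Covariant

/-! ### The two linear defects are parallel. -/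

section Covariant

variable {n : ℕ} {G : Coord n → Mat n} {y : Coord n} {S T : Coord n → Ten3 n}

lemma cov3_sub (hS : Ten3DiffAt S y) (hT : Ten3DiffAt T y) (i j k l : Fin n) :
    cov3 G (fun z i j k => S z i j k - T z i j k) y i j k l
      = cov3 G S y i j k l - cov3 G T y i j k l := by
  simp only [cov3, pd_sub (hS i j k) (hT i j k), Finset.sum_add_distrib, mul_sub,
    Finset.sum_sub_distrib]
  ring

lemma cov3_const_mul (c : ℝ) (hS : Ten3DiffAt S y) (i j k l : Fin n) :
    cov3 G (fun z i j k => c * S z i j k) y i j k l = c * cov3 G S y i j k l := by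
  simp only [cov3, pd_const_mul c (hS i j k), mul_sub, Finset.mul_sum, mul_add]
  congr 1
  exact Finset.sum_congr rfl fun a _ => by ring

lemma cov3_swap12 (i j k l : Fin n) :
    cov3 G (fun z i j k => S z j i k) y i j k l = cov3 G S y j i k l := by
  simp only [cov3]
  congr 1
  exact Finset.sum_congr rfl fun a _ => by ring

lemma cov3_swap23 (i j k l : Fin n) :
    cov3 G (fun z i j k => S z i k j) y i j k l = cov3 G S y i k j l := by
  simp only [cov3]
  congr 1
  exact Finset.sum_congr rfl fun a _ => by ring

lemma cov3_metric_mul (hs : ∀ z, (G z).IsSymm) (hd : MatDiffAt G y) (hu : IsUnit (G y).det)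
    {v : Coord n → Ten1 n} (hv : ∀ i, DifferentiableAt ℝ (fun z => v z i) y) (i j k l : Fin n) :
    cov3 G (fun z i j k => G z i j * v z k) y i j k l = G y i j * cov1 G v y k l := by
  simp only [cov3, cov1, pd_mul (hd i j) (hv k), pd_metric hs hu, Finset.sum_add_distrib,
    mul_sub, Finset.mul_sum, Finset.sum_mul, add_mul]
  have : ∀ x, christoffel G y x l k * (G y i j * v y x) = G y i j * (christoffel G y x l k * v y x) :=
    fun x => by ring
  simp only [this, mul_assoc]
  ring

/-- The tensor `T_{ijk} - T_{jik}`. -/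
def antisym12 {n : ℕ} (T : Ten3 n) : Ten3 n := fun i j k => T i j k - T j i k

/-- The tensor `T_{ijk} - T_{ikj} - (1 + 2 / n) (g_{ik} t̄_j - g_{ij} t̄_k)`. -/
def hookDefect {n : ℕ} (G : Mat n) (T : Ten3 n) : Ten3 n := fun i j k =>
  T i j k - T i k j - (1 + 2 / (n : ℝ)) * (G i k * tbar G T j - G i j * tbar G T k)

lemma tbar_differentiableAt (hd : MatDiffAt G y) (hu : IsUnit (G y).det) (hT : Ten3DiffAt T y)
    (i : Fin n) : DifferentiableAt ℝ (fun z => tbar (G z) (T z) i) y := by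
  simp only [tbar]
  refine DifferentiableAt.const_mul ?_ _
  exact DifferentiableAt.fun_sum fun j _ => DifferentiableAt.fun_sum fun k _ =>
    (hd.inv hu j k).fun_mul (hT i j k)

lemma Tring_comm12 (hG : (G y).IsSymm) (T : Ten3 n) (i j k : Fin n) :
    Tring (G y) T j i k = Tring (G y) T i j k := by
  have : ∀ i j k, sym3 T j i k = sym3 T i j k := fun i j k => by simp only [sym3]; ring
  simp only [Tring, tracefree3, this i j, hG.apply i j]
  ring

lemma Tring_comm23 (hG : (G y).IsSymm) (T : Ten3 n) (i j k : Fin n) :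
    Tring (G y) T i k j = Tring (G y) T i j k := by
  have : ∀ i j k, sym3 T i k j = sym3 T i j k := fun i j k => by simp only [sym3]; ring
  simp only [Tring, tracefree3, this i j, hG.apply j k]
  ring

/-- The right-hand side of the first equation is symmetric in `i, j`, since `T̊` is totally
symmetric by construction, whatever the symmetries of `T`. -/
lemma cov3_antisym12_eq_zero (hs : ∀ z, (G z).IsSymm) (hT : Ten3DiffAt T y)
    (hE : DerivativeEquations G T y) (i j k l : Fin n) :
    cov3 G (fun z => antisym12 (T z)) y i j k l = 0 := by
  have e := cov3_sub (G := G) hT (fun i j k => hT j i k) i j k l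
  have e2 : cov3 G (fun z => Tring (G z) (T z)) y j i k l
      = cov3 G (fun z => Tring (G z) (T z)) y i j k l := by
    rw [← cov3_swap12]
    congr 1
    funext z i j k
    exact Tring_comm12 (G := G) (hs z) _ _ _ _
  rw [cov3_swap12 (S := T)] at e
  refine e.trans ?_
  have h1 := hE.1 i j k l
  have h2 := hE.1 j i k l
  rw [h1, h2, e2]
  ring

/-- Antisymmetrising the first equation in `j, k` removes `T̊` and leaves `(1 + 2/n) (g_{ik}
t̄_{j,l} - g_{ij} t̄_{k,l})`. This fixes the constant in `hookDefect`. -/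
lemma cov3_hookDefect_eq_zero (hs : ∀ z, (G z).IsSymm) (hd : MatDiffAt G y)
    (hu : IsUnit (G y).det) (hT : Ten3DiffAt T y)
    (hE : DerivativeEquations G T y) (i j k l : Fin n) :
    cov3 G (fun z => hookDefect (G z) (T z)) y i j k l = 0 := by
  have hv := tbar_differentiableAt hd hu hT
  set v : Coord n → Ten1 n := fun z => tbar (G z) (T z) with hvdef
  have d1 : Ten3DiffAt (fun z i j k => T z i j k - T z i k j) y := fun i j k =>
    (hT i j k).fun_sub (hT i k j)
  have d2 : Ten3DiffAt (fun z i j k => G z i j * v z k) y := fun i j k => (hd i j).fun_mul (hv k)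
  have d3 : Ten3DiffAt (fun z i j k => G z i k * v z j) y := fun i j k => (hd i k).fun_mul (hv j)
  have d4 : Ten3DiffAt (fun z i j k => G z i k * v z j - G z i j * v z k) y := fun i j k =>
    (d3 i j k).fun_sub (d2 i j k)
  have d5 : Ten3DiffAt (fun z i j k =>
      (1 + 2 / (n : ℝ)) * (G z i k * v z j - G z i j * v z k)) y := fun i j k =>
    (d4 i j k).const_mul _
  have e := cov3_sub (G := G) d1 d5 i j k l
  rw [cov3_const_mul _ d4, cov3_sub d3 d2, cov3_sub hT (fun i j k => hT i k j), cov3_swap23 (S := T),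
    cov3_swap23 (S := fun z i j k => G z i j * v z k), cov3_metric_mul hs hd hu hv,
    cov3_metric_mul hs hd hu hv] at e
  refine e.trans ?_
  have e2 : cov3 G (fun z => Tring (G z) (T z)) y i k j l
      = cov3 G (fun z => Tring (G z) (T z)) y i j k l := by
    rw [← cov3_swap23]
    congr 1
    funext z i j k
    exact Tring_comm23 (G := G) (hs z) _ _ _ _
  have h1 := hE.1 i j k l
  have h2 := hE.1 i k j l
  rw [h1, h2, e2, (hs y).apply i k, (hs y).apply i j, (hs y).apply j k]
  ring

end Covariant

/-! ### Parallel tensors with a zero vanish. -/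

section Uniqueness

variable {n : ℕ} {G : Coord n → Mat n} {F : Coord n → Ten3 n}

lemma fderiv_eq_sum_pd (f : Coord n → ℝ) (y w : Coord n) :
    fderiv ℝ f y w = ∑ l, w l * pd l f y := by
  have : w = ∑ l, w l • EuclideanSpace.single l (1 : ℝ) := by
    ext i
    simp [Pi.single_apply]
  conv_lhs => rw [this]
  simp [pd]

/-- A parallel tensor field on a ball that vanishes at one point vanishes identically. -/
lemma eq_zero_of_cov3_eq_zero {y₀ y₁ y₂ : Coord n} {r C : ℝ}
    (hF : ∀ y ∈ Metric.ball y₀ r, Ten3DiffAt F y)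
    (hC : ∀ y ∈ Metric.ball y₀ r, ∀ a i j, |christoffel G y a i j| ≤ C)
    (hcov : ∀ y ∈ Metric.ball y₀ r, ∀ i j k l, cov3 G F y i j k l = 0)
    (h₁ : y₁ ∈ Metric.ball y₀ r) (h₂ : y₂ ∈ Metric.ball y₀ r) (h0 : F y₁ = 0) : F y₂ = 0 := by
  set w := y₂ - y₁ with hw
  let γ : ℝ → Coord n := fun s => y₁ + s • w
  have hγ : ∀ s ∈ Set.Icc (0 : ℝ) 1, γ s ∈ Metric.ball y₀ r := fun s hs =>
    (convex_ball y₀ r).add_smul_sub_mem h₁ h₂ hs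
  have hder : ∀ s, HasDerivAt γ w s := fun s => by
    have := ((hasDerivAt_id s).smul_const w).const_add y₁
    rwa [one_smul] at this
  let f : ℝ → Ten3 n := fun s => F (γ s)
  let f' : ℝ → Ten3 n := fun s i j k => ∑ l, w l * pd l (fun z => F z i j k) (γ s)
  have hf : ∀ s ∈ Set.Icc (0 : ℝ) 1, HasDerivAt f (f' s) s := by
    intro s hs
    refine hasDerivAt_pi.2 fun i => hasDerivAt_pi.2 fun j => hasDerivAt_pi.2 fun k => ?_
    have := (hF _ (hγ s hs) i j k).hasFDerivAt.comp_hasDerivAt s (hder s)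
    rwa [fderiv_eq_sum_pd] at this
  -- Along the segment from `y₁` to `y₂`, the parallel equation is a linear ODE with bounded
  -- coefficients, so Grönwall's inequality applies.
  have hb : ∀ s ∈ Set.Ico (0 : ℝ) 1,
      ‖f' s‖ ≤ ((∑ l, |w l|) * ((n : ℝ) * (3 * C))) * ‖f s‖ := by
    intro s hs
    have hs' := Set.Ico_subset_Icc_self hs
    have comp : ∀ a b c, |F (γ s) a b c| ≤ ‖f s‖ := fun a b c =>
      (norm_le_pi_norm (f s a b) c).trans ((norm_le_pi_norm (f s a) b).trans
        (norm_le_pi_norm (f s) a))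
    -- `0 ≤ C` is read off from a Christoffel symbol, which requires an index.
    rcases isEmpty_or_nonempty (Fin n) with hn | ⟨⟨a0⟩⟩
    · have : f' s = 0 := Subsingleton.elim _ _
      have h2 : f s = 0 := Subsingleton.elim _ _
      simp [this, h2]
    have hC0 : 0 ≤ C := (abs_nonneg _).trans (hC _ (hγ s hs') a0 a0 a0)
    have hp : ∀ i j k l, |pd l (fun z => F z i j k) (γ s)| ≤ (n : ℝ) * (3 * C) * ‖f s‖ := by
      intro i j k l
      have h1 := hcov _ (hγ s hs') i j k l
      rw [cov3, sub_eq_zero] at h1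
      rw [h1]
      refine (Finset.abs_sum_le_sum_abs _ _).trans ?_
      have : ∀ a ∈ Finset.univ, |christoffel G (γ s) a l i * F (γ s) a j k
          + christoffel G (γ s) a l j * F (γ s) i a k
          + christoffel G (γ s) a l k * F (γ s) i j a| ≤ 3 * C * ‖f s‖ := by
        intro a _
        have hm : ∀ i x y z, |christoffel G (γ s) a l i * F (γ s) x y z| ≤ C * ‖f s‖ :=
          fun i x y z => by
            rw [abs_mul]
            exact mul_le_mul (hC _ (hγ s hs') _ _ _) (comp _ _ _) (abs_nonneg _) hC0
        refine (abs_add_three _ _ _).trans ?_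
        linarith [hm i a j k, hm j i a k, hm k i j a]
      refine (Finset.sum_le_sum this).trans ?_
      simp [mul_assoc]
    have hK : 0 ≤ ((∑ l, |w l|) * ((n : ℝ) * (3 * C))) * ‖f s‖ := by positivity
    refine (pi_norm_le_iff_of_nonneg hK).2 fun i => (pi_norm_le_iff_of_nonneg hK).2 fun j =>
      (pi_norm_le_iff_of_nonneg hK).2 fun k => ?_
    refine (Finset.abs_sum_le_sum_abs _ _).trans ?_
    rw [mul_assoc, Finset.sum_mul]
    refine Finset.sum_le_sum fun l _ => ?_
    rw [abs_mul]
    exact mul_le_mul_of_nonneg_left (hp i j k l) (abs_nonneg _)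
  have := eq_zero_of_abs_deriv_le_mul_abs_self_of_eq_zero_right
    (fun s hs => (hf s hs).continuousAt.continuousWithinAt)
    (fun s hs => (hf s (Set.Ico_subset_Icc_self hs)).hasDerivWithinAt)
    (by simpa [f, γ] using h0) hb 1 (by simp)
  simpa [f, γ, hw] using this

end Uniqueness

/-! ### Coordinate frames and regularity of the metric components. -/

section Frame

variable {n : ℕ} {M : Type*} [TopologicalSpace M] [ChartedSpace (EuclideanSpace ℝ (Fin n)) M]
  [IsManifold (𝓡 n) ∞ M] {φ : OpenPartialHomeomorph M (EuclideanSpace ℝ (Fin n))}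

/-- The coordinate frame as a basis of the tangent space. -/
def frameBasis (hφ : φ ∈ atlas (EuclideanSpace ℝ (Fin n)) M) {y : Coord n} (hy : y ∈ φ.target) :
    Module.Basis (Fin n) ℝ (TangentSpace (𝓡 n) (φ.symm y)) :=
  (EuclideanSpace.basisFun (Fin n) ℝ).toBasis.map
    ((mdifferentiable_of_mem_atlas (I := 𝓡 n) hφ).symm.mfderiv hy).toLinearEquiv

lemma frameBasis_apply (hφ : φ ∈ atlas (EuclideanSpace ℝ (Fin n)) M) {y : Coord n}
    (hy : y ∈ φ.target) (i : Fin n) : frameBasis hφ hy i = frame φ y i := by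
  have e : (EuclideanSpace.basisFun (Fin n) ℝ).toBasis i = EuclideanSpace.single i (1 : ℝ) := by
    simp
  exact congrArg (mfderiv (𝓡 n) (𝓡 n) φ.symm y) e

variable (g : Metric n M)

lemma gram_isSymm (φ : OpenPartialHomeomorph M (EuclideanSpace ℝ (Fin n))) (y : Coord n) :
    (gram g φ y).IsSymm := by
  ext i j
  exact g.symm _ _ _

lemma gram_posDef (hφ : φ ∈ atlas (EuclideanSpace ℝ (Fin n)) M) {y : Coord n}
    (hy : y ∈ φ.target) : (gram g φ y).PosDef := by
  refine Matrix.PosDef.of_dotProduct_mulVec_pos ?_ fun x hx => ?_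
  · rw [IsHermitian, conjTranspose_eq_transpose_of_trivial]
    exact gram_isSymm g φ y
  · have hne : ∑ i, x i • frame φ y i ≠ 0 := by
      intro h0
      apply hx
      funext i
      simp only [← frameBasis_apply hφ hy] at h0
      exact Fintype.linearIndependent_iff.1 (frameBasis hφ hy).linearIndependent x h0 i
    have := g.pos _ _ hne
    simp only [map_sum, map_smul, _root_.sum_apply, _root_.smul_apply,
      smul_eq_mul] at this
    refine this.trans_eq ?_
    simp only [dotProduct, Matrix.mulVec, gram, of_apply, Finset.mul_sum, star_trivial]
    refine (Finset.sum_congr rfl fun i _ => Finset.sum_congr rfl fun j _ => ?_)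
    rw [g.symm]
    ring

/-- The frame is the tangent map of `φ.symm` applied to a constant vector field. -/
lemma frame_contMDiffOn (hφ : φ ∈ atlas (EuclideanSpace ℝ (Fin n)) M) (i : Fin n) :
    ContMDiffOn (𝓡 n) ((𝓡 n).prod 𝓘(ℝ, EuclideanSpace ℝ (Fin n))) ∞
      (fun y => TotalSpace.mk' (EuclideanSpace ℝ (Fin n)) (φ.symm y) (frame φ y i)) φ.target := by
  have h1 : ContMDiffOn (𝓡 n) (𝓡 n) ∞ φ.symm φ.target :=
    contMDiffOn_symm_of_mem_maximalAtlas (IsManifold.subset_maximalAtlas hφ)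
  have h2 := h1.contMDiffOn_tangentMapWithin (m := ∞) (by simp) φ.open_target.uniqueMDiffOn
  have h3 : ContMDiff (𝓡 n) ((𝓡 n).prod 𝓘(ℝ, EuclideanSpace ℝ (Fin n))) ∞
      (fun y : Coord n => (⟨y, EuclideanSpace.single i (1 : ℝ)⟩ : TangentBundle (𝓡 n) (Coord n))) :=
    fun y => (contMDiffAt_vectorSpace_iff_contDiffAt
      (V := fun _ => EuclideanSpace.single i (1 : ℝ))).2 contDiffAt_const
  have h4 := h2.comp (h3.contMDiffOn (s := φ.target)) (fun y hy => hy)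
  refine h4.congr fun y hy => ?_
  simp only [Function.comp, tangentMapWithin, mfderivWithin_of_isOpen φ.open_target hy]
  rfl

lemma gram_contDiffOn (hφ : φ ∈ atlas (EuclideanSpace ℝ (Fin n)) M) (i j : Fin n) :
    ContDiffOn ℝ ∞ (fun y => gram g φ y i j) φ.target := by
  rw [← contMDiffOn_iff_contDiffOn]
  intro y hy
  have h1 : ContMDiffOn (𝓡 n) (𝓡 n) ∞ φ.symm φ.target :=
    contMDiffOn_symm_of_mem_maximalAtlas (IsManifold.subset_maximalAtlas hφ)
  have : ContMDiffWithinAt (𝓡 n) ((𝓡 n).prod 𝓘(ℝ)) ∞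
      (fun m ↦ TotalSpace.mk' ℝ (E := Bundle.Trivial M ℝ) (φ.symm m)
        (g.inner (φ.symm m) (frame φ m i) (frame φ m j))) φ.target y := by
    apply ContMDiffWithinAt.clm_bundle_apply₂ (F₁ := EuclideanSpace ℝ (Fin n))
      (F₂ := EuclideanSpace ℝ (Fin n))
    · exact ContMDiffAt.comp_contMDiffWithinAt y g.contMDiff.contMDiffAt (h1 y hy)
    · exact frame_contMDiffOn hφ i y hy
    · exact frame_contMDiffOn hφ j y hy
  simp only [contMDiffWithinAt_totalSpace] at this
  exact this.2

lemma gram_matDiffAt (hφ : φ ∈ atlas (EuclideanSpace ℝ (Fin n)) M) {y : Coord n}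
    (hy : y ∈ φ.target) : MatDiffAt (gram g φ) y := fun i j =>
  ((gram_contDiffOn g hφ i j).contDiffAt (φ.open_target.mem_nhds hy)).differentiableAt (by simp)

lemma gram_isUnit (hφ : φ ∈ atlas (EuclideanSpace ℝ (Fin n)) M) {y : Coord n}
    (hy : y ∈ φ.target) : IsUnit (gram g φ y).det := (gram_posDef g hφ hy).det_pos.ne'.isUnit

lemma christoffel_continuousAt (hφ : φ ∈ atlas (EuclideanSpace ℝ (Fin n)) M) {y : Coord n}
    (hy : y ∈ φ.target) (a i j : Fin n) :
    ContinuousAt (fun z => christoffel (gram g φ) z a i j) y := by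
  have hp : ∀ i j l, ContinuousAt (fun z => pd l (fun w => gram g φ w i j) z) y := by
    intro i j l
    have h := (gram_contDiffOn g hφ i j).contDiffAt (φ.open_target.mem_nhds hy)
    have h2 := (h.fderiv_right (m := 0) (by simp)).continuousAt
    exact h2.clm_apply continuousAt_const
  simp only [christoffel]
  refine ContinuousAt.mul continuousAt_const ?_
  refine tendsto_finsetSum _ fun b _ => ContinuousAt.mul
    (((gram_matDiffAt g hφ hy).inv (gram_isUnit g hφ hy) a b).continuousAt) ?_
  exact ((hp _ _ _).add (hp _ _ _)).sub (hp _ _ _)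

lemma exists_ball_christoffel_le (hφ : φ ∈ atlas (EuclideanSpace ℝ (Fin n)) M) {y : Coord n}
    (hy : y ∈ φ.target) : ∃ C : ℝ, ∀ᶠ z in 𝓝 y, ∀ a i j,
      |christoffel (gram g φ) z a i j| ≤ C := by
  refine ⟨∑ a, ∑ i, ∑ j, |christoffel (gram g φ) y a i j| + 1, ?_⟩
  rw [eventually_all]; intro a
  rw [eventually_all]; intro i
  rw [eventually_all]; intro j
  have h := (christoffel_continuousAt g hφ hy a i j).abs
  refine (h.eventually (gt_mem_nhds (lt_add_one _))).mono fun z hz => hz.le.trans ?_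
  gcongr
  refine le_trans ?_ (Finset.single_le_sum
    (f := fun a => ∑ i, ∑ j, |christoffel (gram g φ) y a i j|) (fun a _ => ?_) (Finset.mem_univ a))
  · refine le_trans ?_ (Finset.single_le_sum
      (f := fun i => ∑ j, |christoffel (gram g φ) y a i j|) (fun a _ => ?_) (Finset.mem_univ i))
    · exact Finset.single_le_sum (f := fun j => |christoffel (gram g φ) y a i j|)
        (fun a _ => abs_nonneg _) (Finset.mem_univ j)
    · positivity
  · positivity

end Frame

/-! ### Independence of the frame. -/

section ChangeOfFrame

variable {n : ℕ}

/-- The trace does not depend on the frame. -/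
lemma trace2_change {G P : Mat n} (hP : IsUnit P.det) (A : Mat n) :
    trace2 (Pᵀ * G * P) (fun i j => (Pᵀ * A * P) i j) = trace2 G (fun i j => A i j) := by
  have hPt : IsUnit Pᵀ.det := by rwa [det_transpose]
  rw [trace2_eq_trace, trace2_eq_trace]
  change ((Pᵀ * G * P)⁻¹ * (Pᵀ * A * P)ᵀ).trace = (G⁻¹ * Aᵀ).trace
  simp only [Matrix.mul_inv_rev, transpose_mul, transpose_transpose, Matrix.mul_assoc]
  rw [← Matrix.mul_assoc (Pᵀ)⁻¹, nonsing_inv_mul _ hPt, Matrix.one_mul, Matrix.trace_mul_comm]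
  simp only [Matrix.mul_assoc]
  rw [mul_nonsing_inv _ hP, Matrix.mul_one]

variable {E : Type*} [AddCommGroup E] [Module ℝ E]

/-- The components of a bilinear form. -/
def form2 {n : ℕ} (γ : E →ₗ[ℝ] E →ₗ[ℝ] ℝ) (e : Fin n → E) : Mat n := of fun i j => γ (e i) (e j)

/-- The components of a trilinear form. -/
def form3 {n : ℕ} (τ : E →ₗ[ℝ] E →ₗ[ℝ] E →ₗ[ℝ] ℝ) (e : Fin n → E) : Ten3 n :=
  fun i j k => τ (e i) (e j) (e k)

lemma form2_change (γ : E →ₗ[ℝ] E →ₗ[ℝ] ℝ) (e : Fin n → E) (P : Mat n) :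
    form2 γ (fun i => ∑ a, P a i • e a) = Pᵀ * form2 γ e * P := by
  ext i j
  simp only [form2, of_apply, Matrix.mul_apply, transpose_apply, map_sum, map_smul,
    LinearMap.sum_apply, LinearMap.smul_apply, smul_eq_mul, Finset.sum_mul, Finset.mul_sum]
  refine Finset.sum_congr rfl fun a _ => Finset.sum_congr rfl fun b _ => ?_
  ring

lemma tbar_change (γ : E →ₗ[ℝ] E →ₗ[ℝ] ℝ) (τ : E →ₗ[ℝ] E →ₗ[ℝ] E →ₗ[ℝ] ℝ)
    (e : Fin n → E) {P : Mat n} (hP : IsUnit P.det) (i : Fin n) :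
    tbar (form2 γ fun i => ∑ a, P a i • e a) (form3 τ fun i => ∑ a, P a i • e a) i
      = ∑ a, P a i * tbar (form2 γ e) (form3 τ e) a := by
  have h : ∀ (e : Fin n → E) u, ∑ j, ∑ k, (form2 γ e)⁻¹ j k * τ u (e j) (e k)
      = trace2 (form2 γ e) (fun j k => form2 (τ u) e j k) := fun e u => rfl
  simp only [tbar, form3]
  rw [h, form2_change, form2_change, trace2_change hP]
  simp only [trace2, form2, of_apply, map_sum, map_smul, LinearMap.sum_apply,
    LinearMap.smul_apply, smul_eq_mul, Finset.mul_sum]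
  rw [Finset.sum_congr rfl (fun a _ => Finset.sum_comm), Finset.sum_comm]
  refine Finset.sum_congr rfl fun a _ => Finset.sum_congr rfl fun b _ =>
    Finset.sum_congr rfl fun c _ => ?_
  ring

/-- Trilinearity is assumed of a plain function, so that expressions such as `τ u v w - τ v u w` can
be used directly. -/
lemma eq_zero_of_trilinear {F : E → E → E → ℝ} {e : Fin n → E}
    (he : ⊤ ≤ Submodule.span ℝ (Set.range e))
    (hF : ∀ i j k, F (e i) (e j) (e k) = 0)
    (h1 : ∀ (c : ℝ) u u' v w, F (c • u + u') v w = c * F u v w + F u' v w)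
    (h2 : ∀ (c : ℝ) u v v' w, F u (c • v + v') w = c * F u v w + F u v' w)
    (h3 : ∀ (c : ℝ) u v w w', F u v (c • w + w') = c * F u v w + F u v w') (u v w : E) :
    F u v w = 0 := by
  have key : ∀ f : E → ℝ, (∀ (c : ℝ) u u', f (c • u + u') = c * f u + f u') →
      (∀ i, f (e i) = 0) → ∀ u, f u = 0 := by
    intro f hf h u
    have f0 : f 0 = 0 := by simpa using hf 1 0 0
    refine Submodule.span_induction (p := fun u _ => f u = 0) ?_ f0 ?_ ?_ (he Submodule.mem_top)
    · rintro _ ⟨i, rfl⟩; exact h i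
    · intro x y _ _ hx hy
      simpa [hx, hy] using hf 1 x y
    · intro c x _ hx
      simpa [hx, f0] using hf c x 0
  exact key (fun u => F u v w) (fun c u u' => h1 c u u' v w) (fun i =>
    key (fun v => F (e i) v w) (fun c v v' => h2 c _ v v' w) (fun j =>
      key (fun w => F (e i) (e j) w) (fun c w w' => h3 c _ _ w w') (fun k => hF i j k) w) v) u

/-- Whether the two defects of a trilinear form vanish does not depend on the frame. -/
lemma defects_change (γ : E →ₗ[ℝ] E →ₗ[ℝ] ℝ) (τ : E →ₗ[ℝ] E →ₗ[ℝ] E →ₗ[ℝ] ℝ)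
    (b b' : Module.Basis (Fin n) ℝ E)
    (h1 : antisym12 (form3 τ b) = 0) (h2 : hookDefect (form2 γ b) (form3 τ b) = 0) :
    antisym12 (form3 τ b') = 0 ∧ hookDefect (form2 γ b') (form3 τ b') = 0 := by
  have hs : ⊤ ≤ Submodule.span ℝ (Set.range b) := b.span_eq.ge
  set P : Mat n := b.toMatrix b' with hPdef
  have hb' : (b' : Fin n → E) = fun i => ∑ a, P a i • b a := by
    funext i
    exact (b.sum_toMatrix_smul_self b' i).symm
  have hP : IsUnit P.det := by
    have := congrArg Matrix.det (b.toMatrix_mul_toMatrix_flip b')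
    rw [det_mul, det_one] at this
    exact IsUnit.of_mul_eq_one _ this
  -- The covector `t̄`, defined through the basis `b`. By `tbar_change` it has the right components
  -- in `b'` too, so the hook defect becomes a trilinear form independent of the basis.
  let ν : E →ₗ[ℝ] ℝ := b.constr ℝ (tbar (form2 γ b) (form3 τ b))
  have hν : ∀ i, ν (b i) = tbar (form2 γ b) (form3 τ b) i := fun i => b.constr_basis ℝ _ i
  have hν' : ∀ i, ν (b' i) = tbar (form2 γ b') (form3 τ b') i := by
    intro i
    rw [hb', tbar_change γ τ b hP]
    simp only [map_sum, map_smul, hν, smul_eq_mul]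
  constructor
  · funext i j k
    refine eq_zero_of_trilinear (F := fun u v w => τ u v w - τ v u w) hs
      (fun i j k => congrFun (congrFun (congrFun h1 i) j) k) ?_ ?_ ?_ (b' i) (b' j) (b' k) <;>
    · intros
      simp only [map_add, map_smul, LinearMap.add_apply, LinearMap.smul_apply, smul_eq_mul]
      ring
  · funext i j k
    have := eq_zero_of_trilinear (F := fun u v w => τ u v w - τ u w v
        - (1 + 2 / (n : ℝ)) * (γ u w * ν v - γ u v * ν w)) hs
      (fun i j k => ?_) ?_ ?_ ?_ (b' i) (b' j) (b' k)
    · simp only [hν'] at this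
      exact this
    · have := congrFun (congrFun (congrFun h2 i) j) k
      simp only [hν]
      exact this
    all_goals
      intros
      simp only [map_add, map_smul, LinearMap.add_apply, LinearMap.smul_apply, smul_eq_mul]
      ring

end ChangeOfFrame

/-! ### Spreading the linear identities over `U`. -/

section Propagation

/-- The bilinear form underlying a continuous one. -/
def toBilinear {E : Type*} [AddCommGroup E] [Module ℝ E] [TopologicalSpace E]
    (γ : E →L[ℝ] E →L[ℝ] ℝ) : E →ₗ[ℝ] E →ₗ[ℝ] ℝ :=
  LinearMap.mk₂ ℝ (fun u v => γ u v) (by simp) (by simp) (by simp) (by simp)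

/-- The trilinear form underlying a continuous one. -/
def toTrilinear {E : Type*} [AddCommGroup E] [Module ℝ E] [TopologicalSpace E]
    (τ : E →L[ℝ] E →L[ℝ] E →L[ℝ] ℝ) : E →ₗ[ℝ] E →ₗ[ℝ] E →ₗ[ℝ] ℝ :=
  LinearMap.mk₂ ℝ (fun u v => (τ u v).toLinearMap)
    (fun u u' v => by rw [τ.map_add]; rfl) (fun c u v => by rw [τ.map_smul]; rfl)
    (fun u v v' => by rw [(τ u).map_add]; rfl) (fun c u v => by rw [(τ u).map_smul]; rfl)

lemma components_ten3DiffAt {n : ℕ} {M : Type*} [TopologicalSpace M]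
    [ChartedSpace (EuclideanSpace ℝ (Fin n)) M] {T : TensorField3 n M} {U : Set M} (hU : IsOpen U) (hT : IsC1On T U)
    {φ : OpenPartialHomeomorph M (EuclideanSpace ℝ (Fin n))}
    (hφ : φ ∈ atlas (EuclideanSpace ℝ (Fin n)) M) {y : Coord n} (hy : y ∈ φ.target)
    (hyU : φ.symm y ∈ U) : Ten3DiffAt (components T φ) y := fun i j k =>
  ((hT φ hφ i j k).contDiffAt ((φ.symm.isOpen_inter_preimage hU).mem_nhds
    ⟨hy, hyU⟩)).differentiableAt (by simp)

variable {n : ℕ} {M : Type*} [TopologicalSpace M] [ChartedSpace (EuclideanSpace ℝ (Fin n)) M]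
  [IsManifold (𝓡 n) ∞ M] (g : Metric n M) (T : TensorField3 n M)

/-- The two linear identities between the components of `T` and its trace, in the chart `φ`. -/
def IsReduced (φ : OpenPartialHomeomorph M (EuclideanSpace ℝ (Fin n))) (y : Coord n) : Prop :=
  antisym12 (components T φ y) = 0 ∧ hookDefect (gram g φ y) (components T φ y) = 0

variable {g T}

lemma IsReduced.change {φ ψ : OpenPartialHomeomorph M (EuclideanSpace ℝ (Fin n))}
    (hφ : φ ∈ atlas (EuclideanSpace ℝ (Fin n)) M) (hψ : ψ ∈ atlas (EuclideanSpace ℝ (Fin n)) M)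
    {y z : Coord n} (hy : y ∈ φ.target) (hz : z ∈ ψ.target) (hyz : φ.symm y = ψ.symm z)
    (h : IsReduced g T φ y) : IsReduced g T ψ z := by
  let γ : ∀ x : M, TangentSpace (𝓡 n) x →ₗ[ℝ] TangentSpace (𝓡 n) x →ₗ[ℝ] ℝ := fun x =>
    toBilinear (g.inner x)
  let τ : ∀ x : M, TangentSpace (𝓡 n) x →ₗ[ℝ] TangentSpace (𝓡 n) x →ₗ[ℝ]
      TangentSpace (𝓡 n) x →ₗ[ℝ] ℝ := fun x => toTrilinear (T x)
  have e : ∀ {φ : OpenPartialHomeomorph M (EuclideanSpace ℝ (Fin n))}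
      (hφ : φ ∈ atlas (EuclideanSpace ℝ (Fin n)) M) {y : Coord n} (hy : y ∈ φ.target),
      gram g φ y = form2 (γ (φ.symm y)) (frameBasis hφ hy) ∧
      components T φ y = form3 (τ (φ.symm y)) (frameBasis hφ hy) := by
    intro φ hφ y hy
    have : (frameBasis hφ hy : Fin n → _) = frame φ y := funext fun i => frameBasis_apply hφ hy i
    rw [this]
    exact ⟨rfl, rfl⟩
  -- The base point is made a variable so that substitution identifies the two tangent spaces, which
  -- are equal only propositionally.
  have key : ∀ (x : M) (hx : φ.symm y = x) (b' : Module.Basis (Fin n) ℝ (TangentSpace (𝓡 n) x)),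
      antisym12 (form3 (τ x) b') = 0 ∧ hookDefect (form2 (γ x) b') (form3 (τ x) b') = 0 := by
    rintro x rfl b'
    refine defects_change _ _ (frameBasis hφ hy) b' ?_ ?_
    · rw [← (e hφ hy).2]; exact h.1
    · rw [← (e hφ hy).2, ← (e hφ hy).1]; exact h.2
  have := key _ hyz (frameBasis hψ hz)
  rwa [← (e hψ hz).1, ← (e hψ hz).2] at this

/-- On a ball with bounded Christoffel symbols, a parallel defect vanishes everywhere or nowhere.
The equivalence makes the reduced set and its complement in `U` both open. -/
lemma exists_nhd_isReduced_iff {U : Set M} (hU : IsOpen U) (hT : IsC1On T U)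
    (hE : SolvesOn g T U) {φ : OpenPartialHomeomorph M (EuclideanSpace ℝ (Fin n))}
    (hφ : φ ∈ atlas (EuclideanSpace ℝ (Fin n)) M) {y : Coord n} (hy : y ∈ φ.target)
    (hyU : φ.symm y ∈ U) :
    ∃ r > 0, Metric.ball y r ⊆ φ.target ∧
      ∀ z ∈ Metric.ball y r, (IsReduced g T φ y ↔ IsReduced g T φ z) := by
  obtain ⟨C, hC⟩ := exists_ball_christoffel_le g hφ hy
  have hO := (φ.symm.isOpen_inter_preimage hU).mem_nhds (x := y) ⟨hy, hyU⟩
  obtain ⟨r, hr, hball⟩ := Metric.eventually_nhds_iff_ball.1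
    (hC.and (eventually_mem_set.2 hO))
  refine ⟨r, hr, fun z hz => (hball z hz).2.1, ?_⟩
  have hd : ∀ z ∈ Metric.ball y r, Ten3DiffAt (components T φ) z := fun z hz =>
    components_ten3DiffAt hU hT hφ (hball z hz).2.1 (hball z hz).2.2
  have hs := gram_isSymm g φ
  have hA : ∀ z ∈ Metric.ball y r, ∀ w ∈ Metric.ball y r,
      antisym12 (components T φ z) = 0 → antisym12 (components T φ w) = 0 := by
    intro z hz w hw h0
    refine eq_zero_of_cov3_eq_zero (G := gram g φ) (F := fun z => antisym12 (components T φ z))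
      (fun z hz i j k => (hd z hz i j k).fun_sub (hd z hz j i k))
      (fun z hz => (hball z hz).1)
      (fun z hz => cov3_antisym12_eq_zero hs (hd z hz)
        (hE φ hφ z (hball z hz).2.1 (hball z hz).2.2)) hz hw h0
  have hB : ∀ z ∈ Metric.ball y r, ∀ w ∈ Metric.ball y r,
      hookDefect (gram g φ z) (components T φ z) = 0 →
      hookDefect (gram g φ w) (components T φ w) = 0 := by
    intro z hz w hw h0
    refine eq_zero_of_cov3_eq_zero (G := gram g φ)
      (F := fun z => hookDefect (gram g φ z) (components T φ z))
      (fun z hz i j k => ?_)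
      (fun z hz => (hball z hz).1)
      (fun z hz => cov3_hookDefect_eq_zero hs (gram_matDiffAt g hφ (hball z hz).2.1)
        (gram_isUnit g hφ (hball z hz).2.1) (hd z hz)
        (hE φ hφ z (hball z hz).2.1 (hball z hz).2.2)) hz hw h0
    have hG := gram_matDiffAt g hφ (hball z hz).2.1
    have ht := tbar_differentiableAt hG (gram_isUnit g hφ (hball z hz).2.1) (hd z hz)
    exact ((hd z hz i j k).fun_sub (hd z hz i k j)).fun_sub
      ((((hG i k).fun_mul (ht j)).fun_sub ((hG i j).fun_mul (ht k))).const_mul _)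
  have hyb := Metric.mem_ball_self hr (x := y)
  exact fun z hz => ⟨fun h => ⟨hA y hyb z hz h.1, hB y hyb z hz h.2⟩,
    fun h => ⟨hA z hz y hyb h.1, hB z hz y hyb h.2⟩⟩

/-- The two linear identities propagate over a connected set. -/
lemma isReduced_of_isPreconnected {U : Set M} (hU : IsOpen U) (hUc : IsPreconnected U)
    (hT : IsC1On T U) (hE : SolvesOn g T U) {x₀ : M} (hx₀ : x₀ ∈ U)
    (h₀ : IsReduced g T (chartAt (EuclideanSpace ℝ (Fin n)) x₀)
      (chartAt (EuclideanSpace ℝ (Fin n)) x₀ x₀))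
    {φ : OpenPartialHomeomorph M (EuclideanSpace ℝ (Fin n))}
    (hφ : φ ∈ atlas (EuclideanSpace ℝ (Fin n)) M) {y : Coord n} (hy : y ∈ φ.target)
    (hyU : φ.symm y ∈ U) : IsReduced g T φ y := by
  let R : M → Prop := fun x => IsReduced g T (chartAt (EuclideanSpace ℝ (Fin n)) x)
      (chartAt (EuclideanSpace ℝ (Fin n)) x x)
  have hloc : ∀ x ∈ U, ∀ᶠ x' in 𝓝 x, (R x ↔ R x') := by
    intro x hx
    set ψ := chartAt (EuclideanSpace ℝ (Fin n)) x
    have hxs : x ∈ ψ.source := mem_chart_source _ x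
    obtain ⟨r, hr, hsub, hiff⟩ := exists_nhd_isReduced_iff hU hT hE (chart_mem_atlas _ x)
      (ψ.map_source hxs) (by rwa [ψ.left_inv hxs])
    have h1 : ∀ᶠ x' in 𝓝 x, x' ∈ ψ.source := ψ.open_source.mem_nhds hxs
    have h2 : ∀ᶠ x' in 𝓝 x, ψ x' ∈ Metric.ball (ψ x) r :=
      (ψ.continuousAt hxs).eventually (Metric.ball_mem_nhds _ hr)
    filter_upwards [h1, h2] with x' h1 h2
    rw [show R x ↔ _ from hiff _ h2]
    have hx's := mem_chart_source (EuclideanSpace ℝ (Fin n)) x'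
    have ht' := (chartAt (EuclideanSpace ℝ (Fin n)) x').map_source hx's
    have e : ψ.symm (ψ x') = (chartAt (EuclideanSpace ℝ (Fin n)) x').symm
        (chartAt (EuclideanSpace ℝ (Fin n)) x' x') := by
      rw [ψ.left_inv h1, OpenPartialHomeomorph.left_inv _ hx's]
    exact ⟨fun h => h.change (chart_mem_atlas _ x) (chart_mem_atlas _ x') (hsub h2) ht' e,
      fun h => h.change (chart_mem_atlas _ x') (chart_mem_atlas _ x) ht' (hsub h2) e.symm⟩
  have hopen : ∀ Q : Prop, IsOpen {x | x ∈ U ∧ (R x ↔ Q)} := by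
    intro Q
    rw [isOpen_iff_mem_nhds]
    rintro x ⟨hx, hQ⟩
    filter_upwards [hU.mem_nhds hx, hloc x hx] with x' h1 h2
    exact ⟨h1, h2.symm.trans hQ⟩
  have hall : ∀ x ∈ U, R x := by
    intro x hx
    by_contra hR
    obtain ⟨z, -, hz1, hz2⟩ := hUc _ _ (hopen True) (hopen False)
      (fun z hz => by by_cases h : R z <;> simp [h, hz])
      ⟨x₀, hx₀, hx₀, iff_true_intro h₀⟩ ⟨x, hx, hx, iff_false_intro hR⟩
    exact hz2.2.1 (hz1.2.2 trivial)
  have hs := mem_chart_source (EuclideanSpace ℝ (Fin n)) (φ.symm y)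
  exact (hall _ hyU).change (chart_mem_atlas _ _) hφ
    (OpenPartialHomeomorph.map_source _ hs) hy (OpenPartialHomeomorph.left_inv _ hs)

end Propagation

/-! ### Pointwise consequences of the initial conditions and of the trace equation. -/

section Pointwise

variable {n : ℕ} {G : Mat n} {T : Ten3 n}

lemma tbar_eq_traceT (h : ∀ i j k, T j i k = T i j k) (i : Fin n) :
    tbar G T i = (n : ℝ) / (((n : ℝ) + 2) * ((n : ℝ) - 1)) * traceT G T i := by
  simp only [tbar, traceT, h i]

/-- Given the symmetry in the first two indices, `(1 + 2/n) t̄ = t/(n-1)`, so the linear condition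
is exactly the vanishing of `hookDefect`. -/
lemma defects_eq_zero (hn : 3 ≤ n) (h : Symmetries G T) (hl : LinearCondition G T) :
    antisym12 T = 0 ∧ hookDefect G T = 0 := by
  have hn' : (3 : ℝ) ≤ n := by exact_mod_cast hn
  have h1 : (n : ℝ) - 1 ≠ 0 := by linarith
  constructor
  · funext i j k
    simp [antisym12, h.1 i j k]
  · funext i j k
    have := hl i j k
    simp only [hookDefect, tbar_eq_traceT h.1, Pi.zero_apply]
    field_simp at this ⊢
    linear_combination this

lemma isHarmonic_of_defects (h1 : antisym12 T = 0) (h2 : hookDefect G T = 0)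
    (ht : ∀ j, traceT G T j = 0) : IsHarmonic G T ∧ tbar G T = 0 := by
  have s12 : ∀ i j k, T j i k = T i j k := fun i j k => by
    have := congrFun (congrFun (congrFun h1 i) j) k
    simp only [antisym12, Pi.zero_apply] at this
    linarith
  have htb : ∀ i, tbar G T i = 0 := fun i => by rw [tbar_eq_traceT s12, ht, mul_zero]
  have s23 : ∀ i j k, T i k j = T i j k := fun i j k => by
    have := congrFun (congrFun (congrFun h2 i) j) k
    simp only [hookDefect, Pi.zero_apply, htb, mul_zero, sub_zero] at this
    linarith
  refine ⟨⟨s12, s23, fun k => ?_⟩, funext htb⟩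
  rw [← ht k]
  simp only [trace2, traceT, s23 _ _ k]

lemma ricciContraction_const (hG : G.IsSymm) (hu : IsUnit G.det) (κ : ℝ) :
    ricciContraction G (fun i j k l => κ * (G i k * G j l - G i l * G j k))
      = fun j l => κ * (n - 1) * G j l := by
  funext j l
  change trace2 G (fun a b => κ * (G a b * G j l - G a l * G j b)) = _
  have e1 : trace2 G (fun a b => G a b * G j l) = n * G j l := by
    rw [← trace2_metric hG hu, mul_comm, ← trace2_smul]
    simp only [mul_comm]
  have e2 : trace2 G (fun a b => G a l * G j b) = G j l := by
    rw [← trace2_metric_mul' hG hu G j l]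
    congr 1
    funext a b
    rw [hG.apply b j, mul_comm]
  rw [trace2_smul, trace2_sub, e1, e2]
  ring

/-- The multiple of the metric that `S_i^{ab} S_{jab}` is, when the curvature is `κ`. -/
def squareFactor (n : ℕ) (κ : ℝ) : ℝ :=
  -(9 * ((n : ℝ) + 2) * ((n : ℝ) - 1)) / (3 * n + 2) * κ

lemma squareFactor_eq_zero (hn : 3 ≤ n) {κ : ℝ} (h : squareFactor n κ = 0) : κ = 0 := by
  have hn' : (3 : ℝ) ≤ n := by exact_mod_cast hn
  have h1 : (n : ℝ) - 1 ≠ 0 := by linarith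
  have h2 : (n : ℝ) + 2 ≠ 0 := by linarith
  have h3 : 3 * (n : ℝ) + 2 ≠ 0 := by linarith
  simpa [squareFactor, h1, h2, h3] using h

/-- The trace-free part and the trace of the equation vanish separately. The former makes the square
a multiple of `g`, and the latter, the vanishing of the scalar bracket `X`, determines the multiple.
-/
lemma square2_eq_of_trace_equation (hn : 3 ≤ n) (hG : G.IsSymm) (hu : IsUnit G.det) {κ : ℝ}
    (S : Ten3 n)
    (h : ∀ k l, 0 = 1 / 3 * tracefree2 G (fun p q => -2 / ((n : ℝ) - 2) * square2 G S p q) k l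
      + 1 / (n : ℝ) * G k l *
        ((3 * (n : ℝ) + 2) / (6 * ((n : ℝ) + 2) * ((n : ℝ) - 1)) * normSq3 G S
          + 3 / (2 * ((n : ℝ) - 1)) * (κ * (n - 1) * n))) (i j : Fin n) :
    square2 G S i j = squareFactor n κ * G i j := by
  have hn' : (3 : ℝ) ≤ n := by exact_mod_cast hn
  have h0 : (n : ℝ) ≠ 0 := by linarith
  have h1 : (n : ℝ) - 1 ≠ 0 := by linarith
  have h2 : (n : ℝ) - 2 ≠ 0 := by linarith
  have h3 : (n : ℝ) + 2 ≠ 0 := by linarith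
  have h4 : 3 * (n : ℝ) + 2 ≠ 0 := by linarith
  set X := (3 * (n : ℝ) + 2) / (6 * ((n : ℝ) + 2) * ((n : ℝ) - 1)) * normSq3 G S
          + 3 / (2 * ((n : ℝ) - 1)) * (κ * (n - 1) * n) with hX
  have e : ∀ k l, (n : ℝ) * square2 G S k l
      = normSq3 G S * G k l + 3 * (n - 2) / 2 * X * G k l := by
    intro k l
    have := h k l
    simp only [tracefree2, trace2_smul] at this
    change 0 = 1 / 3 * (-2 / ((n : ℝ) - 2) * square2 G S k l - 1 / (n : ℝ) * G k l *
      (-2 / ((n : ℝ) - 2) * normSq3 G S)) + 1 / (n : ℝ) * G k l * X at this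
    clear_value X
    field_simp at this ⊢
    linear_combination this
  have e2 : (n : ℝ) * normSq3 G S = normSq3 G S * n + 3 * (n - 2) / 2 * X * n := by
    have : trace2 G (fun k l => (n : ℝ) * square2 G S k l)
        = trace2 G (fun k l => normSq3 G S * G k l + 3 * (n - 2) / 2 * X * G k l) := by
      simp only [e]
    rw [trace2_add, trace2_smul, (trace2_smul _ (fun i j => G i j)).trans
      (by rw [trace2_metric hG hu]), (trace2_smul _ (fun i j => G i j)).trans
      (by rw [trace2_metric hG hu])] at this
    exact this
  have hX0 : X = 0 := by
    have : (3 * ((n : ℝ) - 2) / 2 * n) * X = 0 := by linear_combination -e2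
    refine (mul_eq_zero.1 this).resolve_left ?_
    positivity
  have hN : normSq3 G S = n * squareFactor n κ := by
    rw [hX0] at hX
    rw [squareFactor]
    field_simp at hX ⊢
    linear_combination (-1 / 2) * hX
  have := e i j
  rw [hX0, hN] at this
  apply mul_left_cancel₀ h0
  linear_combination this

lemma contr31_zero (S : Ten3 n) (i j : Fin n) : contr31 G S 0 i j = 0 := by
  simp [contr31]

lemma normSq1_zero : normSq1 G (0 : Ten1 n) = 0 := by
  simp [normSq1]

end Pointwise

/-! ### The system in a chart where `t̄` vanishes. -/

section Chart

variable {n : ℕ} {G : Coord n → Mat n} {T : Coord n → Ten3 n} {y : Coord n}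

lemma cov1_eq_zero (h : ∀ᶠ z in 𝓝 y, tbar (G z) (T z) = 0) (k l : Fin n) :
    cov1 G (fun z => tbar (G z) (T z)) y k l = 0 := by
  have e : (fun z => tbar (G z) (T z) k) =ᶠ[𝓝 y] fun _ => 0 := h.mono fun z hz => by simp [hz]
  simp only [cov1, pd_congr e, h.self_of_nhds]
  simp [pd]

lemma scal_of_constant (hs : (G y).IsSymm) (hu : IsUnit (G y).det) {κ : ℝ}
    (hκ : ∀ i j k l, riemann G y i j k l = κ * (G y i k * G y j l - G y i l * G y j k)) :
    scal G y = κ * (n - 1) * n := by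
  have : riemann G y = fun i j k l => κ * (G y i k * G y j l - G y i l * G y j k) := by
    funext i j k l; exact hκ i j k l
  rw [scal, ricci, this, ricciContraction_const hs hu, ← trace2_metric hs hu, ← trace2_smul]

lemma square2_eq (hn : 3 ≤ n) (hs : (G y).IsSymm) (hu : IsUnit (G y).det) {κ : ℝ}
    (hκ : ∀ i j k l, riemann G y i j k l = κ * (G y i k * G y j l - G y i l * G y j k))
    (hE : DerivativeEquations G T y) (hh : IsHarmonic (G y) (T y))
    (ht : ∀ᶠ z in 𝓝 y, tbar (G z) (T z) = 0) (i j : Fin n) :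
    square2 (G y) (T y) i j = squareFactor n κ * G y i j := by
  refine square2_eq_of_trace_equation hn hs hu _ (fun k l => ?_) i j
  have := hE.2.2 k l
  rw [cov1_eq_zero ht, ht.self_of_nhds, Tring_eq_self hh, scal_of_constant hs hu hκ] at this
  simp only [contr31_zero, normSq1_zero, Pi.zero_apply, mul_zero, add_zero, sub_zero] at this
  exact this

lemma cov3_eq_derivRHS (hE : DerivativeEquations G T y) (hh : IsHarmonic (G y) (T y))
    (ht : ∀ᶠ z in 𝓝 y, tbar (G z) (T z) = 0) (i j k l : Fin n) :
    cov3 G T y i j k l = derivRHS (G y) (T y) l i j k := by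
  have h1 := hE.1 i j k l
  have h2 := hE.2.1 i j k l
  rw [cov1_eq_zero ht, cov1_eq_zero ht, cov1_eq_zero ht] at h1
  rw [h1, h2, ht.self_of_nhds, Tring_eq_self hh]
  simp only [contr31_zero, Pi.zero_apply, mul_zero, add_zero, sub_zero, zero_mul, derivRHS]

lemma curvature_eq_zero (hn : 3 ≤ n) (hs : ∀ z, (G z).IsSymm) (hd : MatDiffAt G y)
    (hu : IsUnit (G y).det) (hT : Ten3DiffAt T y) {κ : ℝ}
    (hh : ∀ᶠ z in 𝓝 y, IsHarmonic (G z) (T z))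
    (hq : ∀ᶠ z in 𝓝 y, ∀ i j, square2 (G z) (T z) i j = squareFactor n κ * G z i j)
    (hE : DerivativeEquations G T y) (ht : ∀ᶠ z in 𝓝 y, tbar (G z) (T z) = 0)
    (hW : WeylCondition G (T y) y) : κ = 0 := by
  refine squareFactor_eq_zero hn ?_
  have h := hh.self_of_nhds
  have hqy := hq.self_of_nhds
  refine eq_zero_of_cubic hn (G := G y) (S := T y) ?_ hqy
    (cubic_of_weyl hn (hs y) hu h hqy fun i j k l => ?_) fun i j l => ?_
  · intro h0
    have : Nonempty (Fin n) := ⟨⟨0, by omega⟩⟩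
    rw [h0, det_zero] at hu
    exact not_isUnit_zero hu
  · have := hW i j k l
    linarith [this.1, this.2]
  -- Both summands are given by `trace_raise_derivRHS`, whose value is symmetric in `i, j`; hence
  -- each of them vanishes.
  · have := raise_cov3_add_eq_zero hs hd hu hT hh hq i j l
    have e : (fun i j k => cov3 G T y i j k l) = derivRHS (G y) (T y) l := by
      funext i j k; exact cov3_eq_derivRHS hE h ht i j k l
    rw [e, trace_raise_derivRHS hn (hs y) hu h hqy, trace_raise_derivRHS hn (hs y) hu h hqy,
      cubic_swap (hs y) h j i l, h.swap12 i j l] at this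
    linarith

end Chart

end StructureTensor

end

/-! ### Assembly of the theorem. -/

open StructureTensor Filter Topology in
theorem mainTheorem10 (n : ℕ) (hn : 3 ≤ n)
    {M : Type*} [TopologicalSpace M] [ChartedSpace (EuclideanSpace ℝ (Fin n)) M]
    [IsManifold (𝓡 n) ∞ M]
    (g : StructureTensor.Metric n M)
    (hg : ∃ κ : ℝ, StructureTensor.HasConstantCurvature g κ)
    (x₀ : M) (U : Set M) (hU : IsOpen U) (hUconn : IsPreconnected U) (hx₀U : x₀ ∈ U)
    (T : StructureTensor.TensorField3 n M)
    (hTreg : StructureTensor.IsC1On T U)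
    (hTeq : StructureTensor.SolvesOn g T U)
    (hTinit : StructureTensor.AdmissibleAt g T x₀)
    (V : Set M) (hV : IsOpen V) (hVU : V ⊆ U) (hx₀V : x₀ ∈ V)
    (ht : StructureTensor.TraceVanishesOn g T V) :
    (∀ x ∈ V, T x = 0) ∧ StructureTensor.IsFlat g := by
  obtain ⟨κ, hκ⟩ := hg
  have h0 := hTinit _ (chart_mem_atlas _ x₀) (mem_chart_source (EuclideanSpace ℝ (Fin n)) x₀)
  have hred : ∀ φ ∈ atlas (EuclideanSpace ℝ (Fin n)) M, ∀ y ∈ φ.target, φ.symm y ∈ V →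
      IsHarmonic (gram g φ y) (components T φ y) ∧ tbar (gram g φ y) (components T φ y) = 0 := by
    intro φ hφ y hy hyV
    have h := isReduced_of_isPreconnected hU hUconn hTreg hTeq hx₀U
      (defects_eq_zero hn h0.1 h0.2.1) hφ hy (hVU hyV)
    exact isHarmonic_of_defects h.1 h.2 (ht φ hφ y hy hyV)
  have hnhd : ∀ φ : OpenPartialHomeomorph M (EuclideanSpace ℝ (Fin n)), ∀ y ∈ φ.target,
      φ.symm y ∈ V → ∀ᶠ z in 𝓝 y, z ∈ φ.target ∧ φ.symm z ∈ V := fun φ y hy hyV =>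
    (φ.symm.isOpen_inter_preimage hV).mem_nhds ⟨hy, hyV⟩
  have hsq : ∀ φ ∈ atlas (EuclideanSpace ℝ (Fin n)) M, ∀ y ∈ φ.target, φ.symm y ∈ V →
      ∀ i j, square2 (gram g φ y) (components T φ y) i j
        = squareFactor n κ * gram g φ y i j := by
    intro φ hφ y hy hyV
    exact square2_eq hn (gram_isSymm g φ y) (gram_isUnit g hφ hy) (hκ φ hφ y hy)
      (hTeq φ hφ y hy (hVU hyV)) (hred φ hφ y hy hyV).1
      ((hnhd φ y hy hyV).mono fun z hz => (hred φ hφ z hz.1 hz.2).2)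
  -- The Weyl condition is available at `x₀` only; one point suffices because `κ` is constant on
  -- `M`.
  have hκ0 : κ = 0 := by
    set φ := chartAt (EuclideanSpace ℝ (Fin n)) x₀
    have hφ : φ ∈ atlas (EuclideanSpace ℝ (Fin n)) M := chart_mem_atlas _ x₀
    have hxs : x₀ ∈ φ.source := mem_chart_source _ x₀
    have hy := φ.map_source hxs
    have hyV : φ.symm (φ x₀) ∈ V := by rwa [φ.left_inv hxs]
    have hN := hnhd φ _ hy hyV
    exact curvature_eq_zero hn (gram_isSymm g φ) (gram_matDiffAt g hφ hy) (gram_isUnit g hφ hy)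
      (components_ten3DiffAt hU hTreg hφ hy (hVU hyV))
      (hN.mono fun z hz => (hred φ hφ z hz.1 hz.2).1)
      (hN.mono fun z hz => hsq φ hφ z hz.1 hz.2) (hTeq φ hφ _ hy (hVU hyV))
      (hN.mono fun z hz => (hred φ hφ z hz.1 hz.2).2) h0.2.2.1
  refine ⟨fun x hx => ?_, fun φ hφ y hy i j k l => ?_⟩
  · set φ := chartAt (EuclideanSpace ℝ (Fin n)) x
    have hφ : φ ∈ atlas (EuclideanSpace ℝ (Fin n)) M := chart_mem_atlas _ x
    have hxs : x ∈ φ.source := mem_chart_source _ x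
    have hy := φ.map_source hxs
    have hyV : φ.symm (φ x) ∈ V := by rwa [φ.left_inv hxs]
    have hc : components T φ (φ x) = 0 :=
      eq_zero_of_square2_eq_zero (gram_posDef g hφ hy) fun i => by
        rw [hsq φ hφ _ hy hyV, hκ0, squareFactor, mul_zero, zero_mul]
    have hz : T (φ.symm (φ x)) = 0 := by
      have hb := frameBasis_apply (M := M) hφ hy
      ext u v w
      exact eq_zero_of_trilinear (F := fun u v w => T (φ.symm (φ x)) u v w)
        (frameBasis hφ hy).span_eq.ge
        (fun i j k => by
          simp only [hb]
          exact congrFun (congrFun (congrFun hc i) j) k)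
        (fun c u u' v w => by simp) (fun c u v v' w => by simp) (fun c u v w w' => by simp) u v w
    rwa [φ.left_inv hxs] at hz
  · rw [hκ φ hφ y hy, hκ0, zero_mul]
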